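/- **Setting.** Fix $n\ge 3$ battlefields, budgets $0<X_A\le X_B$, values $w^A_i,w^B_i>0$ ($i\in[n]$) and a tie parameter $\alpha\in[0,1]$. Pure strategies of player $P\in\{A,B\}$ are the $x\in\mathbb R_{\ge0}^n$ with $\sum_i x_i\le X_P$; mixed strategies are probability distributions on the set of pure strategies. A pair of contest success functions (CSFs) is $\zeta=(\zeta_A,\zeta_B)$, $\zeta_P:\mathbb R_{\ge0}^2\to\mathbb R$, with $\zeta_A,\zeta_B\ge0$, $\zeta_A+\zeta_B=1$, $\zeta_A(x,y)$ non-decreasing in $x$ and non-increasing in $y$, and $\zeta_B(x,y)$ non-decreasing in $y$ and non-increasing in $x$. In the generalized Lottery Blotto game $\mathcal{GLB}_n^{X_A,X_B}(\zeta)$ the payoffs are $\Pi^\zeta_P(x^A,x^B)=\sum_i w^P_i\,\zeta_P(x^A_i,x^B_i)$, extended to (independent) mixed strategies by expectation. An $\eta$-equilibrium is a profile of mixed strategies from which no player can gain more than $\eta$ by a unilateral deviation to any mixed strategy. Let $W_P=\sum_i w^P_i$, $W=\max\{W_A,W_B\}$, $v^P_i=w^P_i/W_P$, and, for $\gamma>0$,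 $\Omega_A(\gamma)=\{i: v^A_i/v^B_i>\gamma\}$. Let $\mathcal S_n$ be the set of positive solutions $\gamma$ of $$\frac{X_B\gamma}{X_A}=\frac{\gamma^2\sum_{i\in\Omega_A(\gamma)}\frac{(v^B_i)^2}{v^A_i}+\sum_{i\notin\Omega_A(\gamma)}v^A_i}{\sum_{i\in\Omega_A(\gamma)}v^B_i+\frac1{\gamma^2}\sum_{i\notin\Omega_A(\gamma)}\frac{(v^A_i)^2}{v^B_i}} .$$ For $\gamma^*\in\mathcal S_n$ put $$\lambda_A=\frac{(\gamma^*)^2}{2X_B}\sum_{i\in\Omega_A(\gamma^*)}\frac{(v^B_i)^2}{v^A_i}+\frac1{2X_B}\sum_{i\notin\Omega_A(\gamma^*)}v^A_i,\qquad \lambda_B=\frac1{2X_A}\sum_{i\in\Omega_A(\gamma^*)}v^B_i+\frac1{2(\gamma^*)^2X_A}\sum_{i\notin\Omega_A(\gamma^*)}\frac{(v^A_i)^2}{v^B_i},$$ and $a_i=v^A_i/\lambda_A$, $b_i=v^B_i/\lambda_B$. If $i\in\Omega_A(\gamma^*)$, let $F_{A^*_i}(x)=x/b_i$ and $F_{B^*_i}(x)=(a_i-b_i)/a_i+x/a_i$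 for $x\in[0,b_i]$; otherwise let $F_{A^*_i}(x)=(b_i-a_i)/b_i+x/b_i$ and $F_{B^*_i}(x)=x/a_i$ for $x\in[0,a_i]$ (these are distribution functions of probability laws on the indicated intervals). The strategy profile $\mathrm{IU}^{\gamma^*}=(\mathrm{IU}^{\gamma^*}_A,\mathrm{IU}^{\gamma^*}_B)$ is: for each $P\in\{A,B\}$, draw $p_i\sim F_{P^*_i}$, $i\in[n]$, independently, and allocate $x^P_i=X_P\,p_i/\sum_jp_j$ if $\sum_jp_j>0$, and $x^P=0$ otherwise. Let $\beta_A(x,y)=1,\alpha,0$ according as $x>y$, $x=y$, $x<y$, and $\beta_B=1-\beta_A$. For $\varepsilon>0$, let $\Delta_{\gamma^*}(\zeta,\varepsilon)$ be the set of all $\delta\in[0,1]$ such that, for every $i\in[n]$ and all $x^*,y^*\in[0,2X_B]$, the law $F_{A^*_i}$ gives mass at most $\delta$ to $\{x\in[0,2X_B]:|\zeta_A(x,y^*)-\beta_A(x,y^*)|\ge\varepsilon\}$ and the law $F_{B^*_i}$ gives mass at most $\delta$ to $\{y\in[0,2X_B]:|\zeta_B(x^*,y)-\beta_B(x^*,y)|\ge\varepsilon\}$.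 **Statement.** Let $0<\underline w\le\overline w$ and $0<X_A\le X_B$. There is a sequence of positive numbers $\varepsilon=\varepsilon(n)$, depending only on $n,\underline w,\overline w,X_A,X_B$, with $\varepsilon(n)=\tilde{\mathcal O}(n^{-1/2})$ (that is, $\varepsilon(n)=\mathcal O(n^{-1/2}(\ln n)^k)$ for some $k$), such that for every $n\ge3$, every game $\mathcal{GLB}_n^{X_A,X_B}(\zeta)$ with an arbitrary pair $\zeta$ of CSFs and $\underline w\le w^P_i\le\overline w$ for all $i\in[n]$, $P\in\{A,B\}$ (Assumption (A0)), and every $\alpha\in[0,1]$: for all $\gamma^*\in\mathcal S_n$ and all $\delta\in\Delta_{\gamma^*}(\zeta,\varepsilon(n))$, the profile $\mathrm{IU}^{\gamma^*}$ is an $(8\delta+13\varepsilon(n))W$-equilibrium of $\mathcal{GLB}_n^{X_A,X_B}(\zeta)$. -/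

import Mathlib

open MeasureTheory Filter
open scoped ENNReal

noncomputable section

namespace LotteryBlotto

/-- The data, besides the budgets, of a two-player Blotto game with `n` battlefields: the values
`wA i`, `wB i > 0` that the two players give to battlefield `i`, and the tie-breaking parameter
`α ∈ [0, 1]` of the winner-takes-all rule. -/
structure Params (n : ℕ) where
  wA : Fin n → ℝ
  wB : Fin n → ℝ
  α : ℝ
  wA_pos : ∀ i, 0 < wA i
  wB_pos : ∀ i, 0 < wB i
  α_nonneg : 0 ≤ α
  α_le_one : α ≤ 1

/-- A pair of contest success functions. Only the values on the quadrant `x, y ≥ 0` matter. -/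
structure IsCSF (ζA ζB : ℝ → ℝ → ℝ) : Prop where
  nonneg_A : ∀ x y, 0 ≤ x → 0 ≤ y → 0 ≤ ζA x y
  nonneg_B : ∀ x y, 0 ≤ x → 0 ≤ y → 0 ≤ ζB x y
  add_eq_one : ∀ x y, 0 ≤ x → 0 ≤ y → ζA x y + ζB x y = 1
  mono_A : ∀ y, 0 ≤ y → MonotoneOn (fun x => ζA x y) (Set.Ici 0)
  anti_A : ∀ x, 0 ≤ x → AntitoneOn (fun y => ζA x y) (Set.Ici 0)
  mono_B : ∀ x, 0 ≤ x → MonotoneOn (fun y => ζB x y) (Set.Ici 0)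
  anti_B : ∀ y, 0 ≤ y → AntitoneOn (fun x => ζB x y) (Set.Ici 0)

/-- The Blotto function of player A (winner takes all, ties give `α`). -/
def betaA (α x y : ℝ) : ℝ := if y < x then 1 else if x = y then α else 0

/-- The Blotto function of player B (winner takes all, ties give `1 - α`). -/
def betaB (α x y : ℝ) : ℝ := if x < y then 1 else if y = x then 1 - α else 0

/-- The pure strategies of a player with budget `X`. -/
def pureStrategies (n : ℕ) (X : ℝ) : Set (Fin n → ℝ) :=
  {x | (∀ i, 0 ≤ x i) ∧ ∑ i, x i ≤ X}

/-- A mixed strategy of a player with budget `X`: a joint (Borel) probability distribution of the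
allocations to the battlefields that is concentrated on the pure strategies. -/
def IsMixedStrategy {n : ℕ} (X : ℝ) (s : Measure (Fin n → ℝ)) : Prop :=
  IsProbabilityMeasure s ∧ ∀ᵐ x ∂s, x ∈ pureStrategies n X

/-- The joint law of the numbers `a i / (∑ j, a j) * X` (all `0` if the sum vanishes), where the
`a i` are independent with laws `F i`. -/
def independentRescaled {n : ℕ} (X : ℝ) (F : Fin n → Measure ℝ) : Measure (Fin n → ℝ) :=
  (Measure.pi F).map fun a i => if ∑ j, a j = 0 then 0 else a i / (∑ j, a j) * X

/-- The measure on `[0, c]` with an atom of mass `m` at `0` and constant density `h`; its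
distribution function is `x ↦ m + x * h` on `[0, c]`, see `uniformType_Iic`. -/
def uniformType (m h c : ℝ) : Measure ℝ :=
  ENNReal.ofReal m • Measure.dirac 0 + ENNReal.ofReal h • volume.restrict (Set.Icc 0 c)

theorem uniformType_Iic {m h c x : ℝ} (hm : 0 ≤ m) (hh : 0 ≤ h) (hx : 0 ≤ x) (hxc : x ≤ c) :
    uniformType m h c (Set.Iic x) = ENNReal.ofReal (m + x * h) := by
  have e : Set.Iic x ∩ Set.Icc 0 c = Set.Icc 0 x := by
    ext t; simp only [Set.mem_inter_iff, Set.mem_Iic, Set.mem_Icc]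
    exact ⟨fun ⟨a, b, _⟩ => ⟨b, a⟩, fun ⟨a, b⟩ => ⟨b, a, b.trans hxc⟩⟩
  simp [uniformType, Measure.restrict_apply measurableSet_Iic, e, hx]
  rw [← ENNReal.ofReal_mul hh, ← ENNReal.ofReal_add hm (by positivity), mul_comm]

instance (m h c : ℝ) : IsFiniteMeasure (uniformType m h c) := by
  constructor
  simp [uniformType, ENNReal.mul_lt_top]

namespace Params

variable {n : ℕ} (G : Params n)

/-- The total value `W_A` of all battlefields for player A. -/
def WA : ℝ := ∑ i, G.wA i

/-- The total value `W_B` of all battlefields for player B. -/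
def WB : ℝ := ∑ i, G.wB i

/-- `W = max {W_A, W_B}`. -/
def W : ℝ := max G.WA G.WB

/-- Normalized values for player A. -/
def vA (i : Fin n) : ℝ := G.wA i / G.WA

/-- Normalized values for player B. -/
def vB (i : Fin n) : ℝ := G.wB i / G.WB

/-- `Ω_A(γ) = {i : v_i^A / v_i^B > γ}`. -/
def OmegaA (γ : ℝ) : Finset (Fin n) := Finset.univ.filter fun i => γ < G.vA i / G.vB i

/-- The set `S_n` of positive solutions `γ` of the equation that fixes the ratio of the
multipliers. -/
def gammaSolutions (XA XB : ℝ) : Set ℝ :=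
  {γ | 0 < γ ∧
    XB * γ / XA =
      (γ ^ 2 * ∑ i ∈ G.OmegaA γ, G.vB i ^ 2 / G.vA i + ∑ i ∈ (G.OmegaA γ)ᶜ, G.vA i) /
      (∑ i ∈ G.OmegaA γ, G.vB i + 1 / γ ^ 2 * ∑ i ∈ (G.OmegaA γ)ᶜ, G.vA i ^ 2 / G.vB i)}

/-- The constant `λ_A^*` attached to `γ`. -/
def lamA (XB γ : ℝ) : ℝ :=
  γ ^ 2 / (2 * XB) * ∑ i ∈ G.OmegaA γ, G.vB i ^ 2 / G.vA i +
    1 / (2 * XB) * ∑ i ∈ (G.OmegaA γ)ᶜ, G.vA i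

/-- The constant `λ_B^*` attached to `γ`. -/
def lamB (XA γ : ℝ) : ℝ :=
  1 / (2 * XA) * ∑ i ∈ G.OmegaA γ, G.vB i +
    1 / (2 * γ ^ 2 * XA) * ∑ i ∈ (G.OmegaA γ)ᶜ, G.vA i ^ 2 / G.vB i

/-- The uniform-type law of `A_i^*`: for `i ∈ Ω_A(γ)` it is uniform on `[0, v_i^B / λ_B]`;
otherwise it has the distribution function
`(v_i^B/λ_B - v_i^A/λ_A) / (v_i^B/λ_B) + x λ_B / v_i^B` on `[0, v_i^A / λ_A]`. -/
def lawA (XA XB γ : ℝ) (i : Fin n) : Measure ℝ :=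
  let a := G.vA i / G.lamA XB γ
  let b := G.vB i / G.lamB XA γ
  if i ∈ G.OmegaA γ then uniformType 0 (G.lamB XA γ / G.vB i) b
  else uniformType ((b - a) / b) (G.lamB XA γ / G.vB i) a

/-- The uniform-type law of `B_i^*`: for `i ∉ Ω_A(γ)` it is uniform on `[0, v_i^A / λ_A]`;
otherwise it has the distribution function
`(v_i^A/λ_A - v_i^B/λ_B) / (v_i^A/λ_A) + x λ_A / v_i^A` on `[0, v_i^B / λ_B]`. -/
def lawB (XA XB γ : ℝ) (i : Fin n) : Measure ℝ :=
  let a := G.vA i / G.lamA XB γ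
  let b := G.vB i / G.lamB XA γ
  if i ∈ G.OmegaA γ then uniformType ((a - b) / a) (G.lamA XB γ / G.vA i) b
  else uniformType 0 (G.lamA XB γ / G.vA i) a

/-- The independently uniform strategy of player A. -/
def IUA (XA XB γ : ℝ) : Measure (Fin n → ℝ) := independentRescaled XA (G.lawA XA XB γ)

/-- The independently uniform strategy of player B. -/
def IUB (XA XB γ : ℝ) : Measure (Fin n → ℝ) := independentRescaled XB (G.lawB XA XB γ)

/-- The payoff of player A for a pure strategy profile. -/
def purePayoffA (ζA : ℝ → ℝ → ℝ) (x y : Fin n → ℝ) : ℝ := ∑ i, G.wA i * ζA (x i) (y i)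

/-- The payoff of player B for a pure strategy profile. -/
def purePayoffB (ζB : ℝ → ℝ → ℝ) (x y : Fin n → ℝ) : ℝ := ∑ i, G.wB i * ζB (x i) (y i)

/-- The (expected) payoff of player A for a mixed strategy profile. The integrand is integrable
by `integrable_purePayoffA`. -/
def payoffA (ζA : ℝ → ℝ → ℝ) (s t : Measure (Fin n → ℝ)) : ℝ :=
  ∫ p, G.purePayoffA ζA p.1 p.2 ∂(s.prod t)

/-- The (expected) payoff of player B for a mixed strategy profile. The integrand is integrable
by `integrable_purePayoffB`. -/
def payoffB (ζB : ℝ → ℝ → ℝ) (s t : Measure (Fin n → ℝ)) : ℝ :=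
  ∫ p, G.purePayoffB ζB p.1 p.2 ∂(s.prod t)

/-- `(s, t)` is an `η`-equilibrium of the generalized Lottery Blotto game with budgets `XA`, `XB`
and contest success functions `ζA`, `ζB`. -/
def IsApproxEquilibrium (XA XB : ℝ) (ζA ζB : ℝ → ℝ → ℝ) (η : ℝ)
    (s t : Measure (Fin n → ℝ)) : Prop :=
  IsMixedStrategy XA s ∧ IsMixedStrategy XB t ∧
  (∀ s', IsMixedStrategy XA s' → G.payoffA ζA s' t ≤ G.payoffA ζA s t + η) ∧
  (∀ t', IsMixedStrategy XB t' → G.payoffB ζB s t' ≤ G.payoffB ζB s t + η)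

/-- The allocations `x` of player A at which `ζA` is `ε`-away from the Blotto function, against
the allocation `y`. -/
def Xset (XB : ℝ) (ζA : ℝ → ℝ → ℝ) (y ε : ℝ) : Set ℝ :=
  {x | x ∈ Set.Icc 0 (2 * XB) ∧ ε ≤ |ζA x y - betaA G.α x y|}

/-- The allocations `y` of player B at which `ζB` is `ε`-away from the Blotto function, against
the allocation `x`. -/
def Yset (XB : ℝ) (ζB : ℝ → ℝ → ℝ) (x ε : ℝ) : Set ℝ :=
  {y | y ∈ Set.Icc 0 (2 * XB) ∧ ε ≤ |ζB x y - betaB G.α x y|}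

/-- The set `Δ_γ(ζ, ε)`. -/
def Delta (XA XB : ℝ) (ζA ζB : ℝ → ℝ → ℝ) (γ ε : ℝ) : Set ℝ :=
  {δ | δ ∈ Set.Icc 0 1 ∧
    (∀ i, ∀ y ∈ Set.Icc 0 (2 * XB), (G.lawA XA XB γ i).real (G.Xset XB ζA y ε) ≤ δ) ∧
    (∀ i, ∀ x ∈ Set.Icc 0 (2 * XB), (G.lawB XA XB γ i).real (G.Yset XB ζB x ε) ≤ δ)}

/-- The values of all battlefields for both players lie in `[wlo, whi]`. -/
def ValuesIn (wlo whi : ℝ) : Prop :=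
  ∀ i, (wlo ≤ G.wA i ∧ G.wA i ≤ whi) ∧ (wlo ≤ G.wB i ∧ G.wB i ≤ whi)

end Params

/-- `f(n) = Õ(n^{-1/2})`: big-O up to a power of `log n`. -/
def IsSoftOInvSqrt (f : ℕ → ℝ) : Prop :=
  ∃ k : ℕ, f =O[atTop] fun n : ℕ => (n : ℝ) ^ (-(1 / 2) : ℝ) * Real.log n ^ k

/-! Well-definedness of the expected payoffs. -/

theorem aemeasurable_of_monotone_of_measurable {f : ℝ → ℝ → ℝ} (hm : ∀ y, Monotone fun x => f x y)
    (hy : ∀ x, Measurable (f x)) (h0 : ∀ x y, 0 ≤ f x y) (h1 : ∀ x y, f x y ≤ 1)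
    (μ ν : Measure ℝ) [IsFiniteMeasure μ] [IsFiniteMeasure ν] :
    AEMeasurable (fun p : ℝ × ℝ => f p.1 p.2) (μ.prod ν) := by
  have hat : {x : ℝ | 0 < μ {x}}.Countable :=
    Measure.countable_meas_pos_of_disjoint_iUnion (fun x => measurableSet_singleton x)
      (fun x y hxy => by simpa using hxy)
  obtain ⟨D, hDc, hD⟩ := TopologicalSpace.exists_countable_dense ℝ
  set Q : Set ℝ := D ∪ {x : ℝ | 0 < μ {x}} with hQ
  have hQc : Q.Countable := hDc.union hat
  have : Countable Q := hQc.to_subtype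
  set g : ℝ × ℝ → ℝ := fun p => ⨆ q : Q, if (q : ℝ) ≤ p.1 then f q p.2 else 0 with hg
  set h : ℝ × ℝ → ℝ := fun p => ⨅ q : Q, if p.1 ≤ (q : ℝ) then f q p.2 else 1 with hh
  have gm : Measurable g := Measurable.iSup fun q =>
    Measurable.ite (measurableSet_le measurable_const measurable_fst)
      ((hy q).comp measurable_snd) measurable_const
  have hmeas : Measurable h := Measurable.iInf fun q =>
    Measurable.ite (measurableSet_le measurable_fst measurable_const)
      ((hy q).comp measurable_snd) measurable_const
  have bg : ∀ p : ℝ × ℝ, BddAbove (Set.range fun q : Q => if (q : ℝ) ≤ p.1 then f q p.2 else 0) :=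
    fun p => ⟨1, by rintro _ ⟨q, rfl⟩; dsimp only; split_ifs <;> simp [h1]⟩
  have bh : ∀ p : ℝ × ℝ, BddBelow (Set.range fun q : Q => if p.1 ≤ (q : ℝ) then f q p.2 else 1) :=
    fun p => ⟨0, by rintro _ ⟨q, rfl⟩; dsimp only; split_ifs <;> simp [h0]⟩
  obtain ⟨q0, hq0⟩ := hD.nonempty
  have : Nonempty Q := ⟨⟨q0, Or.inl hq0⟩⟩
  have gle : ∀ p, g p ≤ f p.1 p.2 := fun p => ciSup_le fun q => by
    split_ifs with hq
    · exact hm p.2 hq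
    · exact h0 _ _
  have leh : ∀ p, f p.1 p.2 ≤ h p := fun p => le_ciInf fun q => by
    split_ifs with hq
    · exact hm p.2 hq
    · exact h1 _ _
  have null : ∀ y, ∀ᵐ x ∂μ, g (x, y) = h (x, y) := by
    intro y
    have hc := (hm y).countable_not_continuousAt
    have hn : μ ({x | ¬ContinuousAt (fun x => f x y) x} \ Q) = 0 := by
      refine (measure_null_iff_singleton (hc.mono Set.sdiff_subset)).2 fun x hx => ?_
      by_contra hne
      exact hx.2 (Or.inr (pos_iff_ne_zero.2 hne))
    filter_upwards [measure_eq_zero_iff_ae_notMem.1 hn] with x hx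
    refine le_antisymm ((gle _).trans (leh _)) ?_
    by_cases hxQ : x ∈ Q
    · have a : f x y ≤ g (x, y) := by
        simpa using le_ciSup (bg (x, y)) ⟨x, hxQ⟩
      have b : h (x, y) ≤ f x y := by
        simpa using ciInf_le (bh (x, y)) ⟨x, hxQ⟩
      exact b.trans a
    · have hcx : ContinuousAt (fun x => f x y) x := by
        by_contra hne
        exact hx ⟨hne, hxQ⟩
      refine le_of_forall_pos_le_add fun e he => ?_
      obtain ⟨d, hd, hdx⟩ := Metric.continuousAt_iff.1 hcx (e / 2) (by positivity)
      obtain ⟨q, hqD, hq⟩ := hD.exists_between (show x - d < x by linarith)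
      obtain ⟨r, hrD, hr⟩ := hD.exists_between (show x < x + d by linarith)
      have a : f q y ≤ g (x, y) := by
        simpa [hq.2.le] using le_ciSup (bg (x, y)) ⟨q, Or.inl hqD⟩
      have b : h (x, y) ≤ f r y := by
        simpa [hr.1.le] using ciInf_le (bh (x, y)) ⟨r, Or.inl hrD⟩
      have c1 := hdx (x := q) (by rw [Real.dist_eq, abs_lt]; constructor <;> linarith [hq.1, hq.2])
      have c2 := hdx (x := r) (by rw [Real.dist_eq, abs_lt]; constructor <;> linarith [hr.1, hr.2])
      rw [Real.dist_eq, abs_lt] at c1 c2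
      linarith [c1.1, c2.2]
  have hS : MeasurableSet {p : ℝ × ℝ | g p = h p} := measurableSet_eq_fun gm hmeas
  have key : ∀ᵐ p ∂(μ.prod ν), g p = h p := by
    have hsw : ∀ᵐ p ∂(ν.prod μ), g p.swap = h p.swap := by
      refine (Measure.ae_prod_iff_ae_ae (hS.preimage measurable_swap)).2 ?_
      exact Filter.Eventually.of_forall fun y => null y
    have : ∀ᵐ p ∂((ν.prod μ).map Prod.swap), g p = h p :=
      (ae_map_iff measurable_swap.aemeasurable hS).2 hsw
    rwa [Measure.prod_swap] at this
  exact ⟨g, gm, key.mono fun p hp => le_antisymm ((leh p).trans hp.ge) (gle p)⟩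

theorem IsCSF.integrable_A {ζA ζB : ℝ → ℝ → ℝ} (hζ : IsCSF ζA ζB) {n : ℕ} {XA XB : ℝ}
    {s t : Measure (Fin n → ℝ)} (hs : IsMixedStrategy XA s) (ht : IsMixedStrategy XB t)
    (i : Fin n) :
    Integrable (fun p : (Fin n → ℝ) × (Fin n → ℝ) => ζA (p.1 i) (p.2 i)) (s.prod t) := by
  have := hs.1
  have := ht.1
  set f : ℝ → ℝ → ℝ := fun x y => ζA (max x 0) (max y 0) with hf
  have f0 : ∀ x y, 0 ≤ f x y := fun x y => hζ.nonneg_A _ _ (le_max_right _ _) (le_max_right _ _)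
  have f1 : ∀ x y, f x y ≤ 1 := fun x y => by
    have h1 := hζ.add_eq_one (max x 0) (max y 0) (le_max_right _ _) (le_max_right _ _)
    have h2 := hζ.nonneg_B (max x 0) (max y 0) (le_max_right _ _) (le_max_right _ _)
    simp only [hf]; linarith
  have fm : ∀ y, Monotone fun x => f x y := fun y a b hab =>
    hζ.mono_A _ (le_max_right _ _) (le_max_right a 0) (le_max_right b 0) (max_le_max_right 0 hab)
  have fy : ∀ x, Measurable (f x) := fun x => Antitone.measurable fun a b hab =>
    hζ.anti_A _ (le_max_right _ _) (le_max_right a 0) (le_max_right b 0) (max_le_max_right 0 hab)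
  have h := aemeasurable_of_monotone_of_measurable fm fy f0 f1
    (s.map fun x => x i) (t.map fun y => y i)
  rw [Measure.map_prod_map _ _ (measurable_pi_apply i) (measurable_pi_apply i)] at h
  have h' := h.comp_measurable
    (f := Prod.map (fun x : Fin n → ℝ => x i) (fun y : Fin n → ℝ => y i)) (by fun_prop)
  have hi : Integrable (fun p : (Fin n → ℝ) × (Fin n → ℝ) => f (p.1 i) (p.2 i)) (s.prod t) := by
    refine Integrable.of_bound h'.aestronglyMeasurable 1 (Eventually.of_forall fun p => ?_)
    rw [Real.norm_eq_abs, abs_of_nonneg (f0 _ _)]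
    exact f1 _ _
  refine hi.congr ?_
  have e1 : ∀ᵐ p ∂(s.prod t), p.1 ∈ pureStrategies n XA := Measure.quasiMeasurePreserving_fst.ae hs.2
  have e2 : ∀ᵐ p ∂(s.prod t), p.2 ∈ pureStrategies n XB := Measure.quasiMeasurePreserving_snd.ae ht.2
  filter_upwards [e1, e2] with p h1 h2
  simp [hf, h1.1 i, h2.1 i]

theorem IsCSF.integrable_B {ζA ζB : ℝ → ℝ → ℝ} (hζ : IsCSF ζA ζB) {n : ℕ} {XA XB : ℝ}
    {s t : Measure (Fin n → ℝ)} (hs : IsMixedStrategy XA s) (ht : IsMixedStrategy XB t)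
    (i : Fin n) :
    Integrable (fun p : (Fin n → ℝ) × (Fin n → ℝ) => ζB (p.1 i) (p.2 i)) (s.prod t) := by
  have := hs.1
  have := ht.1
  have e1 : ∀ᵐ p ∂(s.prod t), p.1 ∈ pureStrategies n XA := Measure.quasiMeasurePreserving_fst.ae hs.2
  have e2 : ∀ᵐ p ∂(s.prod t), p.2 ∈ pureStrategies n XB := Measure.quasiMeasurePreserving_snd.ae ht.2
  refine ((integrable_const (1 : ℝ)).sub (hζ.integrable_A hs ht i)).congr ?_
  filter_upwards [e1, e2] with p h1 h2
  have := hζ.add_eq_one (p.1 i) (p.2 i) (h1.1 i) (h2.1 i)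
  simp only [Pi.sub_apply]; linarith

theorem Params.integrable_purePayoffA {n : ℕ} (G : Params n) {ζA ζB : ℝ → ℝ → ℝ}
    (hζ : IsCSF ζA ζB) {XA XB : ℝ} {s t : Measure (Fin n → ℝ)} (hs : IsMixedStrategy XA s)
    (ht : IsMixedStrategy XB t) :
    Integrable (fun p => G.purePayoffA ζA p.1 p.2) (s.prod t) :=
  integrable_finsetSum _ fun i _ => (hζ.integrable_A hs ht i).const_mul _

theorem Params.integrable_purePayoffB {n : ℕ} (G : Params n) {ζA ζB : ℝ → ℝ → ℝ}
    (hζ : IsCSF ζA ζB) {XA XB : ℝ} {s t : Measure (Fin n → ℝ)} (hs : IsMixedStrategy XA s)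
    (ht : IsMixedStrategy XB t) :
    Integrable (fun p => G.purePayoffB ζB p.1 p.2) (s.prod t) :=
  integrable_finsetSum _ fun i _ => (hζ.integrable_B hs ht i).const_mul _

end LotteryBlotto

end

/-! The laws `lawA i` and `lawB i` have a common upper end `cap i`, and their distribution functions
are affine on [0, cap i], with slopes proportional to λ_B / w^B_i and λ_A / w^A_i. Against marginals
`lawB i`, winner-takes-all gives A on battlefield i at most the value of an affine function of its
allocation x, with slope l = W_A λ_A for every i. No allocation of the budget therefore earns more
than Σ w_i m'_i + l X_A, where m'_i is the atom of `lawB i` at 0. The laws `lawA i` reach this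
bound: their means add up to exactly X_A, which is how the multipliers are defined, and at most one
of the two laws of a battlefield has an atom at 0, so ties there cost nothing. The situation of B is
symmetric.

Three errors separate this ideal game from the actual one. Replacing the Blotto function by the CSF
costs δ + ε per evaluation (`integral_mem_of_close_to_blotto`). Rescaling the independent draws to
the budget costs τ = 2t/X + p, where p bounds the probability that the sum misses X by t or more
(`abs_integral_independentRescaled_sub_le`). A deviation thus gains at most (3τ + 2δ + 2ε) times the
player's total value (`deviation_gain_le`).

The probability p comes from Hoeffding's inequality. Since the values are comparable and the means
sum to X_A + X_B, every cap is at most C/n (`card_mul_cap_le`). The sum then fluctuates on the scale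
n^(-1/2), and one logarithm in t makes p of the same order. CSFs need not be continuous:
monotonicity alone turns a small dilation of the argument into a small change of expectation. -/

namespace LotteryBlotto

/-! ### Uniform-type laws: means, tails, dilations -/

section UniformType

variable {m h c : ℝ}

theorem ae_mem_Icc_uniformType (hc : 0 ≤ c) : ∀ᵐ x ∂uniformType m h c, x ∈ Set.Icc 0 c := by
  rw [uniformType, ae_add_measure_iff]
  refine ⟨Measure.ae_smul_measure ?_ _, Measure.ae_smul_measure ?_ _⟩
  · exact (ae_dirac_iff measurableSet_Icc).2 ⟨le_rfl, hc⟩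
  · exact ae_restrict_mem measurableSet_Icc

theorem isProbabilityMeasure_uniformType (hm : 0 ≤ m) (hh : 0 ≤ h) (hc : 0 ≤ c)
    (h1 : m + h * c = 1) : IsProbabilityMeasure (uniformType m h c) := by
  constructor
  simp only [uniformType, Measure.coe_add, Measure.coe_smul, Pi.add_apply, Pi.smul_apply,
    measure_univ, smul_eq_mul, mul_one, Measure.restrict_apply_univ, Real.volume_Icc, sub_zero]
  rw [← ENNReal.ofReal_mul hh, ← ENNReal.ofReal_add hm (by positivity), h1, ENNReal.ofReal_one]

theorem integral_uniformType (hm : 0 ≤ m) (hh : 0 ≤ h) (hc : 0 ≤ c) {f : ℝ → ℝ}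
    (hf : IntervalIntegrable f volume 0 c) :
    ∫ x, f x ∂uniformType m h c = m * f 0 + h * ∫ x in 0..c, f x := by
  have hf' : Integrable f (volume.restrict (Set.Icc 0 c)) :=
    (intervalIntegrable_iff_integrableOn_Icc_of_le hc).1 hf
  rw [uniformType, integral_add_measure ((integrable_dirac (by simp)).smul_measure (by simp))
    (hf'.smul_measure (by simp)), integral_smul_measure, integral_smul_measure, integral_dirac,
    ENNReal.toReal_ofReal hm, ENNReal.toReal_ofReal hh, integral_Icc_eq_integral_Ioc,
    intervalIntegral.integral_of_le hc]
  simp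

theorem integral_id_uniformType (hm : 0 ≤ m) (hh : 0 ≤ h) (hc : 0 ≤ c) :
    ∫ x, x ∂uniformType m h c = h * c ^ 2 / 2 := by
  rw [integral_uniformType hm hh hc (f := fun x => x) (by simp), integral_id]
  ring

/-- The affine majorant persists beyond the cap, so it covers arbitrary deviations. -/
theorem uniformType_real_Iic_le (hm : 0 ≤ m) (hh : 0 ≤ h) {x : ℝ} (hx : 0 ≤ x) :
    (uniformType m h c).real (Set.Iic x) ≤ m + h * x := by
  refine ENNReal.toReal_le_of_le_ofReal (by positivity) ?_
  have e : (volume.restrict (Set.Icc 0 c)) (Set.Iic x) ≤ ENNReal.ofReal x := by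
    rw [Measure.restrict_apply measurableSet_Iic]
    refine (measure_mono (t := Set.Icc 0 x) fun t ht => ⟨ht.2.1, ht.1⟩).trans ?_
    simp
  rw [ENNReal.ofReal_add hm (by positivity), ENNReal.ofReal_mul hh]
  simp only [uniformType, Measure.coe_add, Measure.coe_smul, Pi.add_apply, Pi.smul_apply,
    smul_eq_mul]
  gcongr
  calc ENNReal.ofReal m * (Measure.dirac 0) (Set.Iic x) ≤ ENNReal.ofReal m * 1 := by
        gcongr; exact prob_le_one
    _ = _ := mul_one _

/-- Strictness of 0 < x places the atom at 0 inside the open half-line. -/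
theorem le_uniformType_real_Iio (hm : 0 ≤ m) (hh : 0 ≤ h) {x : ℝ} (hx : 0 < x) (hxc : x ≤ c) :
    m + h * x ≤ (uniformType m h c).real (Set.Iio x) := by
  have e : Set.Iio x ∩ Set.Icc 0 c = Set.Ico 0 x := by
    ext t
    exact ⟨fun ht => ⟨ht.2.1, ht.1⟩, fun ht => ⟨ht.2, ht.1, (ht.2.trans_le hxc).le⟩⟩
  rw [measureReal_def]
  simp only [uniformType, Measure.coe_add, Measure.coe_smul, Pi.add_apply, Pi.smul_apply,
    smul_eq_mul, Measure.restrict_apply measurableSet_Iio, e, Real.volume_Ico, sub_zero,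
    Measure.dirac_apply' _ measurableSet_Iio, Set.mem_Iio, hx, Set.indicator_of_mem, Pi.one_apply,
    mul_one]
  rw [← ENNReal.ofReal_mul hh, ← ENNReal.ofReal_add hm (by positivity), ENNReal.toReal_ofReal]
  positivity

/-- A dilation fixes the atom at 0. On the density part, substitution moves the upper end from c to
(1 + κ)c; the extra piece has length κc and weighs at most h c κ ≤ κ. The Jacobian factor is at most
1. -/
theorem integral_comp_mul_uniformType_le (hm : 0 ≤ m) (hh : 0 ≤ h) (hc : 0 ≤ c)
    (h1 : m + h * c = 1) {f : ℝ → ℝ} (hf : Monotone f) (f0 : ∀ x, 0 ≤ f x) (f1 : ∀ x, f x ≤ 1)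
    {κ : ℝ} (hκ : 0 ≤ κ) :
    ∫ x, f ((1 + κ) * x) ∂uniformType m h c ≤ ∫ x, f x ∂uniformType m h c + κ := by
  have k0 : 0 < 1 + κ := by linarith
  have hg : Monotone fun x => f ((1 + κ) * x) := fun a b hab => hf (by gcongr)
  rw [integral_uniformType hm hh hc hg.intervalIntegrable,
    integral_uniformType hm hh hc hf.intervalIntegrable,
    intervalIntegral.integral_comp_mul_left _ k0.ne', mul_zero, smul_eq_mul,
    ← intervalIntegral.integral_add_adjacent_intervals (a := 0) (b := c) (c := (1 + κ) * c) hf.intervalIntegrable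
      hf.intervalIntegrable]
  have a1 : ∫ x in c..(1 + κ) * c, f x ≤ ∫ x in c..(1 + κ) * c, (1 : ℝ) :=
    intervalIntegral.integral_mono_on (by nlinarith) hf.intervalIntegrable (by simp)
      fun x _ => f1 x
  have a2 : 0 ≤ ∫ x in c..(1 + κ) * c, f x :=
    intervalIntegral.integral_nonneg (by nlinarith) fun x _ => f0 x
  have a3 : 0 ≤ ∫ x in 0..c, f x := intervalIntegral.integral_nonneg hc fun x _ => f0 x
  rw [intervalIntegral.integral_const, smul_eq_mul, mul_one] at a1
  have k1 : (1 + κ)⁻¹ ≤ 1 := inv_le_one_of_one_le₀ (by linarith)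
  have a4 : (1 + κ)⁻¹ * ((∫ x in 0..c, f x) + ∫ x in c..(1 + κ) * c, f x) ≤
      (∫ x in 0..c, f x) + κ * c := by
    calc _ ≤ 1 * ((∫ x in 0..c, f x) + ∫ x in c..(1 + κ) * c, f x) := by gcongr
      _ ≤ _ := by linarith
  have a5 := mul_le_mul_of_nonneg_left a4 hh
  have a6 : h * c * κ ≤ 1 * κ := by gcongr; linarith
  linarith

theorem le_integral_comp_mul_uniformType (hm : 0 ≤ m) (hh : 0 ≤ h) (hc : 0 ≤ c)
    (h1 : m + h * c = 1) {f : ℝ → ℝ} (hf : Monotone f) (f0 : ∀ x, 0 ≤ f x) (f1 : ∀ x, f x ≤ 1)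
    {κ : ℝ} (hκ : 0 ≤ κ) (hκ1 : κ < 1) :
    ∫ x, f x ∂uniformType m h c - κ ≤ ∫ x, f ((1 - κ) * x) ∂uniformType m h c := by
  have k0 : 0 < 1 - κ := by linarith
  have hg : Monotone fun x => f ((1 - κ) * x) := fun a b hab => hf (by gcongr)
  rw [integral_uniformType hm hh hc hg.intervalIntegrable,
    integral_uniformType hm hh hc hf.intervalIntegrable,
    intervalIntegral.integral_comp_mul_left _ k0.ne', mul_zero, smul_eq_mul,
    ← intervalIntegral.integral_add_adjacent_intervals (a := 0) (b := (1 - κ) * c) (c := c)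
      hf.intervalIntegrable hf.intervalIntegrable]
  have a1 : ∫ x in (1 - κ) * c..c, f x ≤ ∫ x in (1 - κ) * c..c, (1 : ℝ) :=
    intervalIntegral.integral_mono_on (by nlinarith) hf.intervalIntegrable (by simp)
      fun x _ => f1 x
  have a3 : 0 ≤ ∫ x in 0..(1 - κ) * c, f x :=
    intervalIntegral.integral_nonneg (by positivity) fun x _ => f0 x
  rw [intervalIntegral.integral_const, smul_eq_mul, mul_one] at a1
  have k1 : 1 ≤ (1 - κ)⁻¹ := (one_le_inv₀ k0).2 (by linarith)
  have a4 : (∫ x in 0..(1 - κ) * c, f x) + (∫ x in (1 - κ) * c..c, f x) - κ * c ≤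
      (1 - κ)⁻¹ * ∫ x in 0..(1 - κ) * c, f x := by
    calc _ ≤ 1 * ∫ x in 0..(1 - κ) * c, f x := by linarith
      _ ≤ _ := by gcongr
  have a5 := mul_le_mul_of_nonneg_left a4 hh
  have a6 : h * c * κ ≤ 1 * κ := by gcongr; linarith
  linarith

end UniformType

/-! ### Concentration of the sum and rescaling to the budget -/

theorem ae_pi_forall_mem {n : ℕ} {F : Fin n → Measure ℝ} [∀ i, IsProbabilityMeasure (F i)]
    {s : Fin n → Set ℝ} (hF : ∀ i, ∀ᵐ x ∂F i, x ∈ s i) :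
    ∀ᵐ a ∂Measure.pi F, ∀ i, a i ∈ s i :=
  ae_all_iff.2 fun i => (measurePreserving_eval F i).quasiMeasurePreserving.ae (hF i)

/-- Hoeffding's inequality for a product measure. -/
theorem pi_real_le_abs_sum_sub {n : ℕ} {F : Fin n → Measure ℝ} [∀ i, IsProbabilityMeasure (F i)]
    {D t : ℝ} (hF : ∀ i, ∀ᵐ x ∂F i, x ∈ Set.Icc 0 D) (ht : 0 ≤ t) :
    (Measure.pi F).real {a | t ≤ |∑ i, a i - ∑ i, ∫ x, x ∂F i|} ≤
      2 * Real.exp (-(2 * t ^ 2 / (n * D ^ 2))) := by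
  have sub : ∀ i, ProbabilityTheory.HasSubgaussianMGF
      (fun a : Fin n → ℝ => a i - ∫ x, x ∂F i) ((‖D - 0‖₊ / 2) ^ 2) (Measure.pi F) := by
    intro i
    have := ProbabilityTheory.hasSubgaussianMGF_of_mem_Icc (μ := Measure.pi F)
      (X := fun a => a i) (a := 0) (b := D) (measurable_pi_apply i).aemeasurable
      ((measurePreserving_eval F i).quasiMeasurePreserving.ae (hF i))
    rwa [integral_comp_eval (μ := F) (i := i) (f := fun x : ℝ => x) (by fun_prop)] at this
  have ind : ProbabilityTheory.iIndepFun (fun i (a : Fin n → ℝ) => a i - ∫ x, x ∂F i)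
      (Measure.pi F) :=
    ProbabilityTheory.iIndepFun_pi (X := fun i (x : ℝ) => x - ∫ x, x ∂F i) fun i => by fun_prop
  have h1 := ProbabilityTheory.HasSubgaussianMGF.sum_of_iIndepFun ind
    (s := Finset.univ) fun i _ => sub i
  have e1 := h1.measure_ge_le ht
  have e2 := h1.neg.measure_ge_le ht
  have ec : -t ^ 2 / (2 * ((∑ _i : Fin n, (‖D - 0‖₊ / 2) ^ 2 : NNReal) : ℝ)) =
      -(2 * t ^ 2 / (n * D ^ 2)) := by
    push_cast
    rw [Finset.sum_const, Finset.card_univ, Fintype.card_fin, nsmul_eq_mul, sub_zero, div_pow,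
      Real.norm_eq_abs, sq_abs, neg_div, show (2 * (n * (D ^ 2 / 2 ^ 2)) : ℝ) = n * D ^ 2 / 2 by ring,
      div_div_eq_mul_div, mul_comm (t ^ 2)]
  rw [ec] at e1 e2
  have hsub : {a : Fin n → ℝ | t ≤ |∑ i, a i - ∑ i, ∫ x, x ∂F i|} ⊆
      {a | t ≤ ∑ i, (a i - ∫ x, x ∂F i)} ∪
      {a | t ≤ (-fun a : Fin n → ℝ => ∑ i, (a i - ∫ x, x ∂F i)) a} := by
    intro a ha
    simp only [Set.mem_ofPred_eq, Set.mem_union, Pi.neg_apply, Finset.sum_sub_distrib] at ha ⊢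
    exact le_abs.1 ha
  refine (measureReal_mono hsub).trans ((measureReal_union_le _ _).trans ?_)
  linarith

/-- The map that rescales a vector to the sum `X`. -/
noncomputable def rescale {n : ℕ} (X : ℝ) (a : Fin n → ℝ) : Fin n → ℝ :=
  fun i => if ∑ j, a j = 0 then 0 else a i / (∑ j, a j) * X

theorem measurable_rescale {n : ℕ} (X : ℝ) : Measurable (rescale X : (Fin n → ℝ) → Fin n → ℝ) := by
  refine measurable_pi_lambda _ fun i => ?_
  refine Measurable.ite ?_ measurable_const (by fun_prop)
  exact measurableSet_eq_fun (by fun_prop) measurable_const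

theorem independentRescaled_eq {n : ℕ} (X : ℝ) (F : Fin n → Measure ℝ) :
    independentRescaled X F = (Measure.pi F).map (rescale X) := rfl

theorem isMixedStrategy_independentRescaled {n : ℕ} {X : ℝ} (hX : 0 ≤ X) {F : Fin n → Measure ℝ}
    [∀ i, IsProbabilityMeasure (F i)] (hF : ∀ i, ∀ᵐ x ∂F i, 0 ≤ x) :
    IsMixedStrategy X (independentRescaled X F) := by
  refine ⟨Measure.isProbabilityMeasure_map (measurable_rescale X).aemeasurable, ?_⟩
  have hms : MeasurableSet (pureStrategies n X) := by
    have : pureStrategies n X = (⋂ i, {x | 0 ≤ x i}) ∩ {x | ∑ i, x i ≤ X} := by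
      ext x; simp [pureStrategies]
    rw [this]
    exact (MeasurableSet.iInter fun i => measurableSet_le measurable_const (by fun_prop)).inter
      (measurableSet_le (by fun_prop) measurable_const)
  rw [independentRescaled_eq]
  refine (ae_map_iff (measurable_rescale X).aemeasurable hms).2 ?_
  filter_upwards [ae_pi_forall_mem (s := fun _ => Set.Ici 0) hF] with a ha
  have hs : 0 ≤ ∑ j, a j := Finset.sum_nonneg fun j _ => ha j
  refine ⟨fun i => ?_, ?_⟩
  · simp only [rescale]
    split_ifs
    · exact le_rfl
    · exact mul_nonneg (div_nonneg (ha i) hs) hX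
  · simp only [rescale]
    split_ifs with h0
    · simpa using hX
    · rw [← Finset.sum_mul, ← Finset.sum_div, div_self h0, one_mul]

/-- The scaling factor is X/S with |S - X| < t, and S ≥ X/2 because 2t ≤ X; hence |X/S - 1| ≤ 2t/X.
-/
theorem rescale_mem_Icc {n : ℕ} {X t : ℝ} (hX : 0 < X) (ht : 0 ≤ t) (htX : 2 * t ≤ X)
    {a : Fin n → ℝ} (ha : ∀ i, 0 ≤ a i) (hs : |∑ i, a i - X| < t) (i : Fin n) :
    rescale X a i ∈ Set.Icc ((1 - 2 * t / X) * a i) ((1 + 2 * t / X) * a i) := by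
  rw [abs_lt] at hs
  set S := ∑ i, a i with hS
  have hS0 : 0 < S := by linarith
  have e : rescale X a i = X / S * a i := by
    simp only [rescale, ← hS, if_neg hS0.ne']; ring
  rw [e]
  have hi := ha i
  constructor
  · gcongr
    rw [le_div_iff₀ hS0, sub_mul, div_mul_eq_mul_div, one_mul, sub_le_iff_le_add,
      ← sub_le_iff_le_add', le_div_iff₀ hX]
    nlinarith
  · gcongr
    rw [div_le_iff₀ hS0, add_mul, div_mul_eq_mul_div, one_mul, ← sub_le_iff_le_add',
      le_div_iff₀ hX]
    nlinarith

/-- Expectations of a monotone function of one coordinate change little under rescaling. -/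
theorem abs_integral_independentRescaled_sub_le {n : ℕ} {X t p : ℝ} (hX : 0 < X) (ht : 0 ≤ t)
    (htX : 2 * t < X) {m h c : Fin n → ℝ} (hm : ∀ i, 0 ≤ m i) (hh : ∀ i, 0 ≤ h i)
    (hc : ∀ i, 0 ≤ c i) (h1 : ∀ i, m i + h i * c i = 1)
    (hp : (Measure.pi fun i => uniformType (m i) (h i) (c i)).real {a | t ≤ |∑ i, a i - X|} ≤ p)
    {f : ℝ → ℝ} (hf : Monotone f ∨ Antitone f) (f0 : ∀ x, 0 ≤ f x) (f1 : ∀ x, f x ≤ 1)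
    (i : Fin n) :
    |∫ x, f (x i) ∂independentRescaled X (fun i => uniformType (m i) (h i) (c i)) -
      ∫ x, f x ∂uniformType (m i) (h i) (c i)| ≤ 2 * t / X + p := by
  have inst : ∀ i, IsProbabilityMeasure (uniformType (m i) (h i) (c i)) := fun i =>
    isProbabilityMeasure_uniformType (hm i) (hh i) (hc i) (h1 i)
  wlog hmono : Monotone f generalizing f
  · have hanti : Antitone f := hf.resolve_left hmono
    -- The antitone case follows from the monotone one through 1 - f.
    have hf' : Monotone fun x => 1 - f x := fun a b hab => sub_le_sub_left (hanti hab) 1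
    have key := this (f := fun x => 1 - f x) (Or.inl hf') (fun x => sub_nonneg.2 (f1 x))
      (fun x => by simpa using f0 x) hf'
    have mix := isMixedStrategy_independentRescaled hX.le
      (F := fun i => uniformType (m i) (h i) (c i))
      (fun i => (ae_mem_Icc_uniformType (hc i)).mono fun x hx => hx.1)
    have := mix.1
    have b : ∀ {Ω : Type} [MeasurableSpace Ω] (μ : Measure Ω) [IsProbabilityMeasure μ]
        (g : Ω → ℝ) (_ : Measurable g), Integrable (fun ω => f (g ω)) μ := fun μ _ g hg =>
      Integrable.of_bound (hanti.measurable.comp hg).aestronglyMeasurable 1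
        (Eventually.of_forall fun ω => by
          rw [Real.norm_eq_abs, abs_of_nonneg (f0 _)]; exact f1 _)
    rw [integral_sub (integrable_const _) (b _ (fun x : Fin n → ℝ => x i) (by fun_prop)),
      integral_sub (integrable_const _) (b _ (fun x => x) measurable_id)] at key
    simp only [integral_const, probReal_univ, one_smul] at key
    rw [← abs_neg]
    convert key using 2
    ring
  set F : Fin n → Measure ℝ := fun i => uniformType (m i) (h i) (c i) with hF
  set B : Set (Fin n → ℝ) := {a | t ≤ |∑ i, a i - X|} with hB
  have hBm : MeasurableSet B := measurableSet_le measurable_const (by fun_prop)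
  have hfi : Measurable fun x : Fin n → ℝ => f (x i) :=
    hmono.measurable.comp (measurable_pi_apply i)
  rw [independentRescaled_eq, integral_map (measurable_rescale X).aemeasurable
    hfi.aestronglyMeasurable]
  have hnn : ∀ᵐ a ∂Measure.pi F, ∀ i, a i ∈ Set.Ici (0 : ℝ) :=
    ae_pi_forall_mem fun i => (ae_mem_Icc_uniformType (hc i)).mono fun x hx => hx.1
  have bdd : ∀ g : (Fin n → ℝ) → ℝ, Measurable g → Integrable (fun a => f (g a)) (Measure.pi F) :=
    fun g hg => Integrable.of_bound (hmono.measurable.comp hg).aestronglyMeasurable 1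
      (Eventually.of_forall fun ω => by rw [Real.norm_eq_abs, abs_of_nonneg (f0 _)]; exact f1 _)
  have iB : Integrable (B.indicator fun _ => (1 : ℝ)) (Measure.pi F) :=
    (integrable_const 1).indicator hBm
  have eB : ∫ a, B.indicator (fun _ => (1 : ℝ)) a ∂Measure.pi F ≤ p := by
    rw [integral_indicator_const _ hBm, smul_eq_mul, mul_one]; exact hp
  have mr : Measurable fun a : Fin n → ℝ => rescale X a i :=
    (measurable_pi_apply i).comp (measurable_rescale X)
  have κ0 : 0 ≤ 2 * t / X := by positivity
  have κ1 : 2 * t / X < 1 := by rwa [div_lt_one hX]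
  have ev : ∀ k : ℝ, ∫ a, f (k * a i) ∂Measure.pi F = ∫ x, f (k * x) ∂F i := fun k =>
    integral_comp_eval (μ := F) (f := fun x => f (k * x))
      (hmono.measurable.comp (measurable_const_mul k)).aestronglyMeasurable
  -- Off `B`, the rescaled coordinate lies below a dilation of the original one and monotonicity
  -- applies; on `B`, the indicator absorbs f ≤ 1. The lower bound is the mirror image.
  have up : ∫ a, f (rescale X a i) ∂Measure.pi F ≤ ∫ x, f x ∂F i + 2 * t / X + p := by
    have : ∫ a, f (rescale X a i) ∂Measure.pi F ≤
        ∫ a, (f ((1 + 2 * t / X) * a i) + B.indicator (fun _ => (1 : ℝ)) a) ∂Measure.pi F := by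
      refine integral_mono_ae (bdd _ mr) ((bdd _ (by fun_prop)).add iB) ?_
      filter_upwards [hnn] with a ha
      by_cases hab : a ∈ B
      · simp only [Set.indicator_of_mem hab]; linarith [f1 (rescale X a i), f0 ((1 + 2 * t / X) * a i)]
      · simp only [Set.indicator_of_notMem hab, add_zero]
        exact hmono (rescale_mem_Icc hX ht htX.le ha (not_le.1 hab) i).2
    rw [integral_add (bdd _ (by fun_prop)) iB, ev] at this
    have := integral_comp_mul_uniformType_le (hm i) (hh i) (hc i) (h1 i) hmono f0 f1 κ0
    simp only [hF] at *
    linarith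
  have low : ∫ x, f x ∂F i - 2 * t / X - p ≤ ∫ a, f (rescale X a i) ∂Measure.pi F := by
    have : ∫ a, (f ((1 - 2 * t / X) * a i) - B.indicator (fun _ => (1 : ℝ)) a) ∂Measure.pi F ≤
        ∫ a, f (rescale X a i) ∂Measure.pi F := by
      refine integral_mono_ae ((bdd _ (by fun_prop)).sub iB) (bdd _ mr) ?_
      filter_upwards [hnn] with a ha
      by_cases hab : a ∈ B
      · simp only [Set.indicator_of_mem hab]; linarith [f0 (rescale X a i), f1 ((1 - 2 * t / X) * a i)]
      · simp only [Set.indicator_of_notMem hab, sub_zero]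
        exact hmono (rescale_mem_Icc hX ht htX.le ha (not_le.1 hab) i).1
    rw [integral_sub (bdd _ (by fun_prop)) iB, ev] at this
    have := le_integral_comp_mul_uniformType (hm i) (hh i) (hc i) (h1 i) hmono f0 f1 κ0 κ1
    simp only [hF] at *
    linarith
  rw [abs_le]
  constructor <;> linarith

/-! ### Gain of a deviation -/

theorem integrable_comp_of_mem_unit {Ω : Type*} [MeasurableSpace Ω] (μ : Measure Ω)
    [IsFiniteMeasure μ] {f : ℝ → ℝ} (hf : Measurable f) (f0 : ∀ x, 0 ≤ f x) (f1 : ∀ x, f x ≤ 1)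
    {g : Ω → ℝ} (hg : Measurable g) : Integrable (fun ω => f (g ω)) μ :=
  Integrable.of_bound (hf.comp hg).aestronglyMeasurable 1
    (Eventually.of_forall fun ω => by rw [Real.norm_eq_abs, abs_of_nonneg (f0 _)]; exact f1 _)

theorem integral_mem_Icc_of_mem_unit {Ω : Type*} [MeasurableSpace Ω] (μ : Measure Ω)
    [IsProbabilityMeasure μ] {f : Ω → ℝ} (f0 : ∀ x, 0 ≤ f x) (f1 : ∀ x, f x ≤ 1) :
    ∫ x, f x ∂μ ∈ Set.Icc 0 1 := by
  refine ⟨integral_nonneg f0, ?_⟩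
  have := integral_mono_of_nonneg (Eventually.of_forall f0) (integrable_const (1 : ℝ))
    (Eventually.of_forall f1) (μ := μ)
  simpa using this

/-- If an antitone function is close to a winner-takes-all payoff off a set of small measure, then
its expectation is close to the probability of winning. -/
theorem integral_mem_of_close_to_blotto (ν : Measure ℝ) [IsProbabilityMeasure ν] {f β : ℝ → ℝ}
    {x R δ ε : ℝ} (hf : Antitone f) (f0 : ∀ y, 0 ≤ f y) (f1 : ∀ y, f y ≤ 1)
    (β0 : ∀ y, 0 ≤ β y) (β1 : ∀ y, β y ≤ 1) (βwin : ∀ y, y < x → β y = 1)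
    (βlose : ∀ y, x < y → β y = 0) (hν : ∀ᵐ y ∂ν, y ∈ Set.Icc 0 R) (hε : 0 ≤ ε)
    (hδ : ν.real {y | y ∈ Set.Icc 0 R ∧ ε ≤ |f y - β y|} ≤ δ) :
    ∫ y, f y ∂ν ≤ ν.real (Set.Iic x) + δ + ε ∧ ν.real (Set.Iio x) - δ - ε ≤ ∫ y, f y ∂ν := by
  set s := {y | y ∈ Set.Icc 0 R ∧ ε ≤ |f y - β y|} with hs
  -- No measurability of β is assumed, so `s` is replaced by a measurable hull of the same measure.
  set T := toMeasurable ν s with hT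
  have hTm : MeasurableSet T := measurableSet_toMeasurable _ _
  have eT : ν.real T ≤ δ := by rwa [measureReal_def, hT, measure_toMeasurable]
  have ind : ∀ {A : Set ℝ}, MeasurableSet A → Integrable (A.indicator fun _ => (1 : ℝ)) ν :=
    fun hA => (integrable_const 1).indicator hA
  have eind : ∀ {A : Set ℝ}, MeasurableSet A →
      ∫ y, A.indicator (fun _ => (1 : ℝ)) y ∂ν = ν.real A := fun hA => by
    rw [integral_indicator_const _ hA, smul_eq_mul, mul_one]
  have fi := integrable_comp_of_mem_unit ν hf.measurable f0 f1 measurable_id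
  simp only [id] at fi
  have close : ∀ᵐ y ∂ν, |f y - β y| ≤ T.indicator (fun _ => (1 : ℝ)) y + ε := by
    filter_upwards [hν] with y hy
    by_cases hyT : y ∈ T
    · rw [Set.indicator_of_mem hyT, abs_le]
      constructor <;> linarith [f0 y, f1 y, β0 y, β1 y]
    · rw [Set.indicator_of_notMem hyT, zero_add]
      by_contra! hlt
      exact hyT (subset_toMeasurable _ _ ⟨hy, hlt.le⟩)
  constructor
  · have : ∫ y, f y ∂ν ≤ ∫ y, ((Set.Iic x).indicator (fun _ => (1 : ℝ)) y +
        T.indicator (fun _ => (1 : ℝ)) y + ε) ∂ν := by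
      refine integral_mono_ae fi
        (((ind measurableSet_Iic).add (ind hTm)).add (integrable_const _)) ?_
      filter_upwards [close] with y hy
      -- A tie y = x counts as a win here and as a loss in the lower bound, so the tie rule is
      -- immaterial.
      have hβ : β y ≤ (Set.Iic x).indicator (fun _ => (1 : ℝ)) y := by
        by_cases hyx : y ≤ x
        · rw [Set.indicator_of_mem (Set.mem_Iic.2 hyx)]; exact β1 y
        · rw [βlose y (not_le.1 hyx)]; exact Set.indicator_nonneg (fun _ _ => zero_le_one) y
      linarith [(abs_le.1 hy).2]
    rw [integral_add (f := fun y => (Set.Iic x).indicator (fun _ => (1 : ℝ)) y +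
        T.indicator (fun _ => (1 : ℝ)) y) ((ind measurableSet_Iic).add (ind hTm))
        (integrable_const _),
      integral_add (ind measurableSet_Iic) (ind hTm), eind measurableSet_Iic, eind hTm,
      integral_const, probReal_univ, one_smul] at this
    linarith
  · have : ∫ y, ((Set.Iio x).indicator (fun _ => (1 : ℝ)) y -
        T.indicator (fun _ => (1 : ℝ)) y - ε) ∂ν ≤ ∫ y, f y ∂ν := by
      refine integral_mono_ae
        (((ind measurableSet_Iio).sub (ind hTm)).sub (integrable_const _)) fi ?_
      filter_upwards [close] with y hy
      have hβ : (Set.Iio x).indicator (fun _ => (1 : ℝ)) y ≤ β y := by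
        by_cases hyx : y < x
        · rw [βwin y hyx, Set.indicator_of_mem (Set.mem_Iio.2 hyx)]
        · rw [Set.indicator_of_notMem (by simpa using hyx)]; exact β0 y
      linarith [(abs_le.1 hy).1]
    rw [integral_sub (f := fun y => (Set.Iio x).indicator (fun _ => (1 : ℝ)) y -
        T.indicator (fun _ => (1 : ℝ)) y) ((ind measurableSet_Iio).sub (ind hTm))
        (integrable_const _),
      integral_sub (ind measurableSet_Iio) (ind hTm), eind measurableSet_Iio, eind hTm,
      integral_const, probReal_univ, one_smul] at this
    linarith

/-- The gain of a deviation, for a player whose marginals are close to `uniformType m h c`, against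
an opponent whose marginals are close to `uniformType m' h' c`, if the marginal value
`w i * h' i` of an allocation does not depend on the battlefield. -/
theorem deviation_gain_le {n : ℕ} {X R δ ε τ l : ℝ} {w m h m' h' c : Fin n → ℝ}
    {ζ β : ℝ → ℝ → ℝ} (ζmono : ∀ y, Monotone fun x => ζ x y) (ζanti : ∀ x, Antitone (ζ x))
    (ζ0 : ∀ x y, 0 ≤ ζ x y) (ζ1 : ∀ x y, ζ x y ≤ 1)
    (β0 : ∀ x y, 0 ≤ β x y) (β1 : ∀ x y, β x y ≤ 1) (βwin : ∀ x y, y < x → β x y = 1)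
    (βlose : ∀ x y, x < y → β x y = 0)
    (hw : ∀ i, 0 ≤ w i) (hm : ∀ i, 0 ≤ m i) (hh : ∀ i, 0 ≤ h i)
    (hm' : ∀ i, 0 ≤ m' i) (hh' : ∀ i, 0 ≤ h' i) (hc : ∀ i, 0 ≤ c i)
    (h1 : ∀ i, m i + h i * c i = 1) (h1' : ∀ i, m' i + h' i * c i = 1)
    (hmm : ∀ i, m i * m' i = 0) (hl : ∀ i, w i * h' i = l) (l0 : 0 ≤ l)
    (hsum : ∑ i, ∫ x, x ∂uniformType (m i) (h i) (c i) = X) (hcR : ∀ i, c i ≤ R) (hXR : X ≤ R)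
    (hε : 0 ≤ ε)
    (hδ : ∀ i, ∀ x ∈ Set.Icc 0 R, (uniformType (m' i) (h' i) (c i)).real
      {y | y ∈ Set.Icc 0 R ∧ ε ≤ |ζ x y - β x y|} ≤ δ)
    {s s' t : Measure (Fin n → ℝ)} [IsProbabilityMeasure s] [IsProbabilityMeasure t]
    (hs' : IsMixedStrategy X s')
    (hτs : ∀ f : ℝ → ℝ, (Monotone f ∨ Antitone f) → (∀ x, 0 ≤ f x) → (∀ x, f x ≤ 1) → ∀ i,
      |∫ x, f (x i) ∂s - ∫ x, f x ∂uniformType (m i) (h i) (c i)| ≤ τ)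
    (hτt : ∀ f : ℝ → ℝ, (Monotone f ∨ Antitone f) → (∀ x, 0 ≤ f x) → (∀ x, f x ≤ 1) → ∀ i,
      |∫ x, f (x i) ∂t - ∫ x, f x ∂uniformType (m' i) (h' i) (c i)| ≤ τ) :
    ∑ i, w i * ∫ x, (∫ y, ζ (x i) (y i) ∂t) ∂s' ≤
      ∑ i, w i * ∫ x, (∫ y, ζ (x i) (y i) ∂t) ∂s + (3 * τ + 2 * δ + 2 * ε) * ∑ i, w i := by
  have := hs'.1
  have iμ : ∀ i, IsProbabilityMeasure (uniformType (m i) (h i) (c i)) := fun i =>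
    isProbabilityMeasure_uniformType (hm i) (hh i) (hc i) (h1 i)
  have iν : ∀ i, IsProbabilityMeasure (uniformType (m' i) (h' i) (c i)) := fun i =>
    isProbabilityMeasure_uniformType (hm' i) (hh' i) (hc i) (h1' i)
  set φ : Fin n → ℝ → ℝ := fun i x => ∫ y, ζ x y ∂uniformType (m' i) (h' i) (c i) with hφ
  set ψ : Fin n → ℝ → ℝ := fun i x => ∫ y, ζ x (y i) ∂t with hψ
  have iζ : ∀ {Ω : Type} [MeasurableSpace Ω] (μ : Measure Ω) [IsProbabilityMeasure μ] (x : ℝ)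
      {g : Ω → ℝ} (_ : Measurable g), Integrable (fun ω => ζ x (g ω)) μ := fun μ _ x g hg =>
    integrable_comp_of_mem_unit μ (ζanti x).measurable (ζ0 x) (ζ1 x) hg
  have φmono : ∀ i, Monotone (φ i) := fun i a b hab =>
    integral_mono (iζ _ a measurable_id) (iζ _ b measurable_id) fun y => ζmono y hab
  have ψmono : ∀ i, Monotone (ψ i) := fun i a b hab =>
    integral_mono (iζ _ a (measurable_pi_apply i)) (iζ _ b (measurable_pi_apply i))
      fun y => ζmono (y i) hab
  have φ01 : ∀ i x, φ i x ∈ Set.Icc (0 : ℝ) 1 := fun i x =>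
    integral_mem_Icc_of_mem_unit _ (fun y => ζ0 x y) (fun y => ζ1 x y)
  have ψ01 : ∀ i x, ψ i x ∈ Set.Icc (0 : ℝ) 1 := fun i x =>
    integral_mem_Icc_of_mem_unit _ (fun y => ζ0 x (y i)) (fun y => ζ1 x (y i))
  -- ψ is the payoff against the actual strategy `t`, φ the payoff against the ideal law.
  have ψφ : ∀ i x, |ψ i x - φ i x| ≤ τ := fun i x =>
    hτt (ζ x) (Or.inr (ζanti x)) (ζ0 x) (ζ1 x) i
  have R0 : ∀ i : Fin n, 0 ≤ R := fun i => (hc i).trans (hcR i)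
  have win : ∀ i, ∀ x ∈ Set.Icc 0 R, _ := fun i x hx =>
    integral_mem_of_close_to_blotto (uniformType (m' i) (h' i) (c i)) (ζanti x) (ζ0 x) (ζ1 x)
      (β0 x) (β1 x) (βwin x) (βlose x)
      ((ae_mem_Icc_uniformType (hc i)).mono fun y hy => ⟨hy.1, hy.2.trans (hcR i)⟩) hε (hδ i x hx)
  have upper : ∀ i, ∀ x ∈ Set.Icc 0 R, ψ i x ≤ m' i + h' i * x + (τ + δ + ε) := fun i x hx => by
    linarith [(win i x hx).1, (abs_le.1 (ψφ i x)).2,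
      uniformType_real_Iic_le (c := c i) (hm' i) (hh' i) hx.1]
  have δ0 : ∀ i : Fin n, 0 ≤ δ := fun i =>
    measureReal_nonneg.trans (hδ i 0 ⟨le_rfl, R0 i⟩)
  -- One τ replaces ψ by φ, the other replaces the player's own marginal by its ideal law. With the
  -- single τ in `upper` this makes 3τ.
  have lower : ∀ i, m' i + h' i * (∫ x, x ∂uniformType (m i) (h i) (c i)) - (2 * τ + δ + ε) ≤
      ∫ x, ψ i (x i) ∂s := by
    intro i
    have a1 : ∫ x, φ i (x i) ∂s - τ ≤ ∫ x, ψ i (x i) ∂s := by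
      have iφ := integrable_comp_of_mem_unit s (φmono i).measurable (fun x => (φ01 i x).1)
        (fun x => (φ01 i x).2) (measurable_pi_apply i)
      have iψ := integrable_comp_of_mem_unit s (ψmono i).measurable (fun x => (ψ01 i x).1)
        (fun x => (ψ01 i x).2) (measurable_pi_apply i)
      have := integral_mono (iφ.sub (integrable_const τ)) iψ fun x => by
        have := (abs_le.1 (ψφ i (x i))).1
        simp only [Pi.sub_apply]
        linarith
      simpa [integral_sub iφ (integrable_const τ)] using this
    have a2 := (abs_le.1 (hτs (φ i) (Or.inl (φmono i)) (fun x => (φ01 i x).1)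
      (fun x => (φ01 i x).2) i)).1
    have a3 : m' i + h' i * (∫ x, x ∂uniformType (m i) (h i) (c i)) - (δ + ε) ≤
        ∫ x, φ i x ∂uniformType (m i) (h i) (c i) := by
      rw [integral_uniformType (hm i) (hh i) (hc i) (φmono i).intervalIntegrable,
        integral_uniformType (hm i) (hh i) (hc i) (f := fun x => x) (by simp)]
      have b1 : ∫ x in 0..c i, (m' i - (δ + ε) + h' i * x) ≤ ∫ x in 0..c i, φ i x := by
        -- The endpoint 0 is left out, since the affine lower bound may fail there.
        refine intervalIntegral.integral_mono_on_of_le_Ioo (hc i)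
          (Continuous.intervalIntegrable (by fun_prop) _ _) (φmono i).intervalIntegrable ?_
        intro x hx
        linarith [(win i x ⟨hx.1.le, hx.2.le.trans (hcR i)⟩).2,
          le_uniformType_real_Iio (hm' i) (hh' i) hx.1 hx.2.le]
      rw [intervalIntegral.integral_add (by simp) (Continuous.intervalIntegrable (by fun_prop) _ _),
        intervalIntegral.integral_const, intervalIntegral.integral_const_mul, smul_eq_mul,
        sub_zero] at b1
      have b2 := mul_le_mul_of_nonneg_left b1 (hh i)
      -- The player's own atom contributes at least 0, while the affine formula asks for m m' less
      -- an error; the two agree because m m' = 0.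
      have b3 : 0 ≤ m i * φ i 0 := mul_nonneg (hm i) (φ01 i 0).1
      have b4 : 0 ≤ m i * (δ + ε) := mul_nonneg (hm i) (add_nonneg (δ0 i) hε)
      have b5 : h i * c i = 1 - m i := by linarith [h1 i]
      have b6 : h i * (c i * (m' i - (δ + ε)) + h' i * ∫ x in 0..c i, x) =
          m' i - m i * m' i - (δ + ε) + m i * (δ + ε) + h' i * (h i * ∫ x in 0..c i, x) := by
        linear_combination (m' i - (δ + ε)) * b5
      rw [b6, hmm i] at b2
      linarith
    linarith
  -- The common slope l reduces the affine bounds to l Σ x_i ≤ l X, whatever the deviation.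
  have sum_upper : ∑ i, w i * ∫ x, ψ i (x i) ∂s' ≤
      ∑ i, w i * m' i + l * X + (τ + δ + ε) * ∑ i, w i := by
    have iψ : ∀ i, Integrable (fun x : Fin n → ℝ => w i * ψ i (x i)) s' := fun i =>
      (integrable_comp_of_mem_unit s' (ψmono i).measurable (fun x => (ψ01 i x).1)
        (fun x => (ψ01 i x).2) (measurable_pi_apply i)).const_mul _
    simp_rw [← integral_const_mul]
    rw [← integral_finsetSum _ fun i _ => iψ i]
    have : ∫ x, ∑ i, w i * ψ i (x i) ∂s' ≤
        ∫ x, (∑ i, w i * m' i + l * X + (τ + δ + ε) * ∑ i, w i) ∂s' := by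
      refine integral_mono_ae (integrable_finsetSum _ fun i _ => iψ i) (integrable_const _) ?_
      filter_upwards [hs'.2] with x hx
      have hxX : ∀ i, x i ≤ X := fun i =>
        (Finset.single_le_sum (fun j _ => hx.1 j) (Finset.mem_univ i)).trans hx.2
      calc ∑ i, w i * ψ i (x i)
          ≤ ∑ i, (w i * m' i + l * x i + (τ + δ + ε) * w i) := by
            refine Finset.sum_le_sum fun i _ => ?_
            have := mul_le_mul_of_nonneg_left
              (upper i (x i) ⟨hx.1 i, (hxX i).trans hXR⟩) (hw i)
            rw [← hl i]
            linarith
        _ = ∑ i, w i * m' i + l * ∑ i, x i + (τ + δ + ε) * ∑ i, w i := by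
            rw [Finset.sum_add_distrib, Finset.sum_add_distrib, Finset.mul_sum, Finset.mul_sum]
        _ ≤ _ := by gcongr; exact hx.2
    simpa using this
  have sum_lower : ∑ i, w i * m' i + l * X - (2 * τ + δ + ε) * ∑ i, w i ≤
      ∑ i, w i * ∫ x, ψ i (x i) ∂s := by
    rw [← hsum, Finset.mul_sum, Finset.mul_sum, ← Finset.sum_add_distrib,
      ← Finset.sum_sub_distrib]
    refine Finset.sum_le_sum fun i _ => ?_
    have := mul_le_mul_of_nonneg_left (lower i) (hw i)
    rw [← hl i]
    linarith
  linarith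

/-! ### Multipliers, caps and budget identities -/

namespace Params

variable {n : ℕ} {G : Params n} {XA XB γ : ℝ}

theorem WA_pos (i : Fin n) : 0 < G.WA :=
  Finset.sum_pos (fun j _ => G.wA_pos j) ⟨i, Finset.mem_univ i⟩

theorem WB_pos (i : Fin n) : 0 < G.WB :=
  Finset.sum_pos (fun j _ => G.wB_pos j) ⟨i, Finset.mem_univ i⟩

theorem vA_pos (i : Fin n) : 0 < G.vA i := div_pos (G.wA_pos i) (WA_pos i)

theorem vB_pos (i : Fin n) : 0 < G.vB i := div_pos (G.wB_pos i) (WB_pos i)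

/-- One of the two blocks may be empty, but i₀ lies in the other. -/
theorem sum_add_sum_compl_pos {f g : Fin n → ℝ} (s : Finset (Fin n)) (i₀ : Fin n) {p q : ℝ}
    (hp : 0 < p) (hq : 0 < q) (hf : ∀ i, 0 < f i) (hg : ∀ i, 0 < g i) :
    0 < p * ∑ i ∈ s, f i + q * ∑ i ∈ sᶜ, g i := by
  by_cases h : i₀ ∈ s
  · exact add_pos_of_pos_of_nonneg (mul_pos hp (Finset.sum_pos (fun i _ => hf i) ⟨i₀, h⟩))
      (mul_nonneg hq.le (Finset.sum_nonneg fun i _ => (hg i).le))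
  · exact add_pos_of_nonneg_of_pos (mul_nonneg hp.le (Finset.sum_nonneg fun i _ => (hf i).le))
      (mul_pos hq (Finset.sum_pos (fun i _ => hg i) ⟨i₀, Finset.mem_compl.2 h⟩))

theorem lamA_pos (hXB : 0 < XB) (hγ : 0 < γ) (i : Fin n) : 0 < G.lamA XB γ :=
  sum_add_sum_compl_pos _ i (by positivity) (by positivity)
    (fun j => div_pos (pow_pos (vB_pos j) 2) (vA_pos j)) vA_pos

theorem lamB_pos (hXA : 0 < XA) (hγ : 0 < γ) (i : Fin n) : 0 < G.lamB XA γ :=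
  sum_add_sum_compl_pos _ i (by positivity) (by positivity) vB_pos
    (fun j => div_pos (pow_pos (vA_pos j) 2) (vB_pos j))

/-- A solution `γ` is the ratio of the multipliers. -/
theorem mul_lamB_eq_lamA (hXA : 0 < XA) (hXB : 0 < XB) (hγ : γ ∈ G.gammaSolutions XA XB)
    (i : Fin n) : γ * G.lamB XA γ = G.lamA XB γ := by
  obtain ⟨h0, he⟩ := hγ
  have hB := lamB_pos (G := G) hXA h0 i
  have e1 : γ ^ 2 * ∑ i ∈ G.OmegaA γ, G.vB i ^ 2 / G.vA i + ∑ i ∈ (G.OmegaA γ)ᶜ, G.vA i =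
      2 * XB * G.lamA XB γ := by
    rw [lamA]; field
  have e2 : ∑ i ∈ G.OmegaA γ, G.vB i + 1 / γ ^ 2 * ∑ i ∈ (G.OmegaA γ)ᶜ, G.vA i ^ 2 / G.vB i =
      2 * XA * G.lamB XA γ := by
    rw [lamB]; field
  rw [e1, e2, div_eq_div_iff (by positivity) (by positivity)] at he
  have : (2 * XA * XB) * (γ * G.lamB XA γ) = (2 * XA * XB) * G.lamA XB γ := by linarith
  exact mul_left_cancel₀ (by positivity) this

/-- The common upper end of the supports of `lawA i` and `lawB i`. -/
noncomputable def cap (G : Params n) (XA XB γ : ℝ) (i : Fin n) : ℝ :=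
  min (G.vA i / G.lamA XB γ) (G.vB i / G.lamB XA γ)

/-- Since γ = λ_A / λ_B, the condition v^A_i / v^B_i > γ rearranges to b_i < a_i. The case split of
the laws thereby becomes the minimum in `cap`. -/
theorem mem_OmegaA_iff (hXA : 0 < XA) (hXB : 0 < XB) (hγ : γ ∈ G.gammaSolutions XA XB)
    (i : Fin n) : i ∈ G.OmegaA γ ↔ G.vB i / G.lamB XA γ < G.vA i / G.lamA XB γ := by
  have hA := lamA_pos (G := G) hXB hγ.1 i
  have hB := lamB_pos (G := G) hXA hγ.1 i
  have e := mul_lamB_eq_lamA hXA hXB hγ i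
  have hv := vB_pos (G := G) i
  rw [OmegaA, Finset.mem_filter, div_lt_div_iff₀ hB hA, lt_div_iff₀ hv, ← e,
    ← mul_lt_mul_iff_of_pos_right hB]
  simp only [Finset.mem_univ, true_and]
  rw [show G.vB i * (γ * G.lamB XA γ) = γ * G.vB i * G.lamB XA γ by ring]

theorem cap_of_mem (hXA : 0 < XA) (hXB : 0 < XB) (hγ : γ ∈ G.gammaSolutions XA XB)
    {i : Fin n} (hi : i ∈ G.OmegaA γ) : G.cap XA XB γ i = G.vB i / G.lamB XA γ :=
  min_eq_right ((mem_OmegaA_iff hXA hXB hγ i).1 hi).le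

theorem cap_of_notMem (hXA : 0 < XA) (hXB : 0 < XB) (hγ : γ ∈ G.gammaSolutions XA XB)
    {i : Fin n} (hi : i ∉ G.OmegaA γ) : G.cap XA XB γ i = G.vA i / G.lamA XB γ :=
  min_eq_left (not_lt.1 fun h => hi ((mem_OmegaA_iff hXA hXB hγ i).2 h))

/-- Both cases have the same slope and the atom that normalizes the mass; this atom vanishes when
the cap is b_i. A single formula spares later case distinctions. -/
theorem lawA_eq (hXA : 0 < XA) (hXB : 0 < XB) (hγ : γ ∈ G.gammaSolutions XA XB) (i : Fin n) :
    G.lawA XA XB γ i = uniformType (1 - G.lamB XA γ / G.vB i * G.cap XA XB γ i)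
      (G.lamB XA γ / G.vB i) (G.cap XA XB γ i) := by
  have hA := lamA_pos (G := G) hXB hγ.1 i
  have hB := lamB_pos (G := G) hXA hγ.1 i
  have hv := vB_pos (G := G) i
  rw [lawA]
  split_ifs with hi
  · rw [cap_of_mem hXA hXB hγ hi]
    congr 1
    field
  · rw [cap_of_notMem hXA hXB hγ hi]
    congr 1
    field

theorem lawB_eq (hXA : 0 < XA) (hXB : 0 < XB) (hγ : γ ∈ G.gammaSolutions XA XB) (i : Fin n) :
    G.lawB XA XB γ i = uniformType (1 - G.lamA XB γ / G.vA i * G.cap XA XB γ i)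
      (G.lamA XB γ / G.vA i) (G.cap XA XB γ i) := by
  have hA := lamA_pos (G := G) hXB hγ.1 i
  have hB := lamB_pos (G := G) hXA hγ.1 i
  have hv := vA_pos (G := G) i
  rw [lawB]
  split_ifs with hi
  · rw [cap_of_mem hXA hXB hγ hi]
    congr 1
    field
  · rw [cap_of_notMem hXA hXB hγ hi]
    congr 1
    field

theorem cap_pos (hXA : 0 < XA) (hXB : 0 < XB) (hγ : 0 < γ) (i : Fin n) : 0 < G.cap XA XB γ i :=
  lt_min (div_pos (vA_pos i) (lamA_pos hXB hγ i)) (div_pos (vB_pos i) (lamB_pos hXA hγ i))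

theorem atomA_nonneg (hXA : 0 < XA) (hγ : 0 < γ) (i : Fin n) :
    0 ≤ 1 - G.lamB XA γ / G.vB i * G.cap XA XB γ i := by
  have hB := lamB_pos (G := G) hXA hγ i
  have hv := vB_pos (G := G) i
  have : G.lamB XA γ / G.vB i * G.cap XA XB γ i ≤
      G.lamB XA γ / G.vB i * (G.vB i / G.lamB XA γ) := by
    gcongr; exact min_le_right _ _
  rw [div_mul_div_cancel₀ hv.ne', div_self hB.ne'] at this
  linarith

theorem atomB_nonneg (hXB : 0 < XB) (hγ : 0 < γ) (i : Fin n) :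
    0 ≤ 1 - G.lamA XB γ / G.vA i * G.cap XA XB γ i := by
  have hA := lamA_pos (G := G) hXB hγ i
  have hv := vA_pos (G := G) i
  have : G.lamA XB γ / G.vA i * G.cap XA XB γ i ≤
      G.lamA XB γ / G.vA i * (G.vA i / G.lamA XB γ) := by
    gcongr; exact min_le_left _ _
  rw [div_mul_div_cancel₀ hv.ne', div_self hA.ne'] at this
  linarith

/-- The minimum `cap` equals a_i or b_i, and the corresponding player's atom is then zero. -/
theorem atomA_mul_atomB (hXA : 0 < XA) (hXB : 0 < XB) (hγ : 0 < γ) (i : Fin n) :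
    (1 - G.lamB XA γ / G.vB i * G.cap XA XB γ i) *
      (1 - G.lamA XB γ / G.vA i * G.cap XA XB γ i) = 0 := by
  have hA := lamA_pos (G := G) hXB hγ i
  have hB := lamB_pos (G := G) hXA hγ i
  have hv := vA_pos (G := G) i
  have hv' := vB_pos (G := G) i
  rcases min_choice (G.vA i / G.lamA XB γ) (G.vB i / G.lamB XA γ) with h | h
  · rw [cap, h, div_mul_div_cancel₀ hv.ne', div_self hA.ne', sub_self, mul_zero]
  · rw [cap, h, div_mul_div_cancel₀ hv'.ne', div_self hB.ne', sub_self, zero_mul]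

/-- The mean of the i-th law is (slope) · cap² / 2. Summed over Ω_A and its complement, with λ_A = γ
λ_B in the latter, this is the defining expression of λ_B times X_A / λ_B. -/
theorem sum_integral_lawA (hXA : 0 < XA) (hXB : 0 < XB) (hγ : γ ∈ G.gammaSolutions XA XB)
    (i₀ : Fin n) : ∑ i, ∫ x, x ∂G.lawA XA XB γ i = XA := by
  have hB := lamB_pos (G := G) hXA hγ.1 i₀
  have h0 := hγ.1
  have e := mul_lamB_eq_lamA hXA hXB hγ i₀
  have key : ∀ i, ∫ x, x ∂G.lawA XA XB γ i =
      G.lamB XA γ / G.vB i * G.cap XA XB γ i ^ 2 / 2 := fun i => by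
    rw [lawA_eq hXA hXB hγ, integral_id_uniformType (atomA_nonneg hXA hγ.1 i)
      (div_pos hB (vB_pos i)).le (cap_pos hXA hXB hγ.1 i).le]
  simp_rw [key]
  rw [← Finset.sum_add_sum_compl (G.OmegaA γ)]
  have s1 : ∑ i ∈ G.OmegaA γ, G.lamB XA γ / G.vB i * G.cap XA XB γ i ^ 2 / 2 =
      1 / (2 * G.lamB XA γ) * ∑ i ∈ G.OmegaA γ, G.vB i := by
    rw [Finset.mul_sum]
    refine Finset.sum_congr rfl fun i hi => ?_
    have hv := vB_pos (G := G) i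
    rw [cap_of_mem hXA hXB hγ hi]; field
  have s2 : ∑ i ∈ (G.OmegaA γ)ᶜ, G.lamB XA γ / G.vB i * G.cap XA XB γ i ^ 2 / 2 =
      1 / (2 * γ ^ 2 * G.lamB XA γ) * ∑ i ∈ (G.OmegaA γ)ᶜ, G.vA i ^ 2 / G.vB i := by
    rw [Finset.mul_sum]
    refine Finset.sum_congr rfl fun i hi => ?_
    have hv := vB_pos (G := G) i
    rw [cap_of_notMem hXA hXB hγ (Finset.mem_compl.1 hi), ← e]; field
  rw [s1, s2]
  have d : G.lamB XA γ * (2 * γ ^ 2 * XA) = γ ^ 2 * ∑ i ∈ G.OmegaA γ, G.vB i +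
      ∑ i ∈ (G.OmegaA γ)ᶜ, G.vA i ^ 2 / G.vB i := by
    rw [lamB]; field
  generalize ∑ i ∈ (G.OmegaA γ)ᶜ, G.vA i ^ 2 / G.vB i = S at *
  field_simp
  linarith

theorem sum_integral_lawB (hXA : 0 < XA) (hXB : 0 < XB) (hγ : γ ∈ G.gammaSolutions XA XB)
    (i₀ : Fin n) : ∑ i, ∫ x, x ∂G.lawB XA XB γ i = XB := by
  have hA := lamA_pos (G := G) hXB hγ.1 i₀
  have hB := lamB_pos (G := G) hXA hγ.1 i₀
  have h0 := hγ.1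
  have e := mul_lamB_eq_lamA hXA hXB hγ i₀
  have key : ∀ i, ∫ x, x ∂G.lawB XA XB γ i =
      G.lamA XB γ / G.vA i * G.cap XA XB γ i ^ 2 / 2 := fun i => by
    rw [lawB_eq hXA hXB hγ, integral_id_uniformType (atomB_nonneg hXB hγ.1 i)
      (div_pos hA (vA_pos i)).le (cap_pos hXA hXB hγ.1 i).le]
  simp_rw [key]
  rw [← Finset.sum_add_sum_compl (G.OmegaA γ)]
  have s1 : ∑ i ∈ G.OmegaA γ, G.lamA XB γ / G.vA i * G.cap XA XB γ i ^ 2 / 2 =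
      γ ^ 2 / (2 * G.lamA XB γ) * ∑ i ∈ G.OmegaA γ, G.vB i ^ 2 / G.vA i := by
    rw [Finset.mul_sum]
    refine Finset.sum_congr rfl fun i hi => ?_
    have hv := vA_pos (G := G) i
    rw [cap_of_mem hXA hXB hγ hi, ← e]; field
  have s2 : ∑ i ∈ (G.OmegaA γ)ᶜ, G.lamA XB γ / G.vA i * G.cap XA XB γ i ^ 2 / 2 =
      1 / (2 * G.lamA XB γ) * ∑ i ∈ (G.OmegaA γ)ᶜ, G.vA i := by
    rw [Finset.mul_sum]
    refine Finset.sum_congr rfl fun i hi => ?_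
    have hv := vA_pos (G := G) i
    rw [cap_of_notMem hXA hXB hγ (Finset.mem_compl.1 hi)]; field
  rw [s1, s2]
  have d : G.lamA XB γ * (2 * XB) = γ ^ 2 * ∑ i ∈ G.OmegaA γ, G.vB i ^ 2 / G.vA i +
      ∑ i ∈ (G.OmegaA γ)ᶜ, G.vA i := by
    rw [lamA]; field
  generalize ∑ i ∈ G.OmegaA γ, G.vB i ^ 2 / G.vA i = S at *
  field_simp
  linarith

/-- Total values and multipliers are common to all battlefields, so a_i / a_j and b_i / b_j are
ratios of raw values; the comparison passes to the minimum. -/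
theorem cap_le_mul_cap {wlo whi : ℝ} (hwlo : 0 < wlo) (hG : G.ValuesIn wlo whi)
    (hXA : 0 < XA) (hXB : 0 < XB) (hγ : 0 < γ) (i j : Fin n) :
    G.cap XA XB γ i ≤ whi / wlo * G.cap XA XB γ j := by
  have hA := lamA_pos (G := G) hXB hγ i
  have hB := lamB_pos (G := G) hXA hγ i
  have hw : 0 < whi := hwlo.trans_le ((hG i).1.1.trans (hG i).1.2)
  have key : ∀ {x y : ℝ}, x ≤ whi → wlo ≤ y → x ≤ whi / wlo * y := fun {x y} hx hy => by
    calc x ≤ whi / wlo * wlo := by rwa [div_mul_cancel₀ _ hwlo.ne']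
      _ ≤ _ := by gcongr
  have kA : G.vA i ≤ whi / wlo * G.vA j := by
    rw [vA, vA, ← mul_div_assoc]
    exact div_le_div_of_nonneg_right (key (hG i).1.2 (hG j).1.1) (WA_pos i).le
  have kB : G.vB i ≤ whi / wlo * G.vB j := by
    rw [vB, vB, ← mul_div_assoc]
    exact div_le_div_of_nonneg_right (key (hG i).2.2 (hG j).2.1) (WB_pos i).le
  rw [cap, cap, mul_min_of_nonneg _ _ (by positivity), ← mul_div_assoc, ← mul_div_assoc]
  exact min_le_min (div_le_div_of_nonneg_right kA hA.le) (div_le_div_of_nonneg_right kB hB.le)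

/-- One of the two laws has no atom, hence is uniform on [0, cap] with mean cap / 2. -/
theorem cap_le_integral_add (hXA : 0 < XA) (hXB : 0 < XB) (hγ : γ ∈ G.gammaSolutions XA XB)
    (i : Fin n) : G.cap XA XB γ i ≤
      2 * (∫ x, x ∂G.lawA XA XB γ i + ∫ x, x ∂G.lawB XA XB γ i) := by
  have hA := lamA_pos (G := G) hXB hγ.1 i
  have hB := lamB_pos (G := G) hXA hγ.1 i
  have hv := vA_pos (G := G) i
  have hv' := vB_pos (G := G) i
  have hc := cap_pos (G := G) hXA hXB hγ.1 i
  have h1 := atomA_mul_atomB (G := G) hXA hXB hγ.1 i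
  rw [lawA_eq hXA hXB hγ, lawB_eq hXA hXB hγ,
    integral_id_uniformType (atomA_nonneg hXA hγ.1 i) (div_pos hB hv').le hc.le,
    integral_id_uniformType (atomB_nonneg hXB hγ.1 i) (div_pos hA hv).le hc.le]
  have p1 : 0 ≤ G.lamA XB γ / G.vA i * G.cap XA XB γ i := by positivity
  have p2 : 0 ≤ G.lamB XA γ / G.vB i * G.cap XA XB γ i := by positivity
  have : 1 ≤ G.lamB XA γ / G.vB i * G.cap XA XB γ i +
      G.lamA XB γ / G.vA i * G.cap XA XB γ i := by
    rcases mul_eq_zero.1 h1 with h | h <;> linarith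
  have := mul_le_mul_of_nonneg_left this hc.le
  linarith

/-- The caps are mutually comparable and their sum is controlled by the total mean X_A + X_B ≤ 2
X_B. The bound does not depend on γ, so no estimate of the multipliers is needed. -/
theorem card_mul_cap_le {wlo whi : ℝ} (hwlo : 0 < wlo) (hG : G.ValuesIn wlo whi)
    (hXA : 0 < XA) (hX : XA ≤ XB) (hγ : γ ∈ G.gammaSolutions XA XB) (i : Fin n) :
    n * G.cap XA XB γ i ≤ whi / wlo * (4 * XB) := by
  have hXB := hXA.trans_le hX
  have hw : 0 < whi := hwlo.trans_le ((hG i).1.1.trans (hG i).1.2)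
  calc n * G.cap XA XB γ i = ∑ _j : Fin n, G.cap XA XB γ i := by simp
    _ ≤ ∑ j, whi / wlo * G.cap XA XB γ j :=
        Finset.sum_le_sum fun j _ => cap_le_mul_cap hwlo hG hXA hXB hγ.1 i j
    _ = whi / wlo * ∑ j, G.cap XA XB γ j := by rw [Finset.mul_sum]
    _ ≤ whi / wlo * ∑ j, 2 * (∫ x, x ∂G.lawA XA XB γ j + ∫ x, x ∂G.lawB XA XB γ j) := by
        gcongr with j; exact cap_le_integral_add hXA hXB hγ j
    _ = whi / wlo * (2 * (XA + XB)) := by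
        rw [← Finset.mul_sum, Finset.sum_add_distrib, sum_integral_lawA hXA hXB hγ i,
          sum_integral_lawB hXA hXB hγ i]
    _ ≤ _ := mul_le_mul_of_nonneg_left (by linarith) (by positivity)

/-- Truncation at 0 extends the CSF to a globally monotone function without changing the payoff. The
deviating player's integral stands outermost, here and in `payoffB_eq`, to fit `deviation_gain_le`.
-/
theorem payoffA_eq {ζA ζB : ℝ → ℝ → ℝ} (hζ : IsCSF ζA ζB) {s t : Measure (Fin n → ℝ)}
    (hs : IsMixedStrategy XA s) (ht : IsMixedStrategy XB t) :
    G.payoffA ζA s t =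
      ∑ i, G.wA i * ∫ x, (∫ y, ζA (max (x i) 0) (max (y i) 0) ∂t) ∂s := by
  have := hs.1
  have := ht.1
  simp only [payoffA, purePayoffA]
  rw [integral_finsetSum _ fun i _ => (hζ.integrable_A hs ht i).const_mul _]
  refine Finset.sum_congr rfl fun i _ => ?_
  rw [integral_const_mul, integral_prod _ (hζ.integrable_A hs ht i)]
  congr 1
  refine integral_congr_ae (hs.2.mono fun x hx => integral_congr_ae (ht.2.mono fun y hy => ?_))
  simp only [max_eq_left (hx.1 i), max_eq_left (hy.1 i)]

theorem payoffB_eq {ζA ζB : ℝ → ℝ → ℝ} (hζ : IsCSF ζA ζB) {s t : Measure (Fin n → ℝ)}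
    (hs : IsMixedStrategy XA s) (ht : IsMixedStrategy XB t) :
    G.payoffB ζB s t =
      ∑ i, G.wB i * ∫ y, (∫ x, ζB (max (x i) 0) (max (y i) 0) ∂s) ∂t := by
  have := hs.1
  have := ht.1
  simp only [payoffB, purePayoffB]
  rw [integral_finsetSum _ fun i _ => (hζ.integrable_B hs ht i).const_mul _]
  refine Finset.sum_congr rfl fun i _ => ?_
  rw [integral_const_mul, integral_prod_symm _ (hζ.integrable_B hs ht i)]
  congr 1
  refine integral_congr_ae (ht.2.mono fun y hy => integral_congr_ae (hs.2.mono fun x hx => ?_))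
  simp only [max_eq_left (hx.1 i), max_eq_left (hy.1 i)]

end Params

theorem IsCSF.A_le_one {ζA ζB : ℝ → ℝ → ℝ} (hζ : IsCSF ζA ζB) {x y : ℝ} (hx : 0 ≤ x)
    (hy : 0 ≤ y) : ζA x y ≤ 1 := by
  linarith [hζ.add_eq_one x y hx hy, hζ.nonneg_B x y hx hy]

theorem IsCSF.B_le_one {ζA ζB : ℝ → ℝ → ℝ} (hζ : IsCSF ζA ζB) {x y : ℝ} (hx : 0 ≤ x)
    (hy : 0 ≤ y) : ζB x y ≤ 1 := by
  linarith [hζ.add_eq_one x y hx hy, hζ.nonneg_A x y hx hy]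

theorem betaA_mem_Icc {α : ℝ} (h0 : 0 ≤ α) (h1 : α ≤ 1) (x y : ℝ) :
    betaA α x y ∈ Set.Icc 0 1 := by
  rw [betaA]; split_ifs <;> simp [h0, h1]

theorem betaA_add_betaB (α x y : ℝ) : betaA α x y + betaB α x y = 1 := by
  rcases lt_trichotomy x y with h | h | h
  · simp [betaA, betaB, h, h.not_gt, h.ne]
  · simp [betaA, betaB, h]
  · simp [betaA, betaB, h, h.not_gt, h.ne]

theorem betaA_of_lt {α x y : ℝ} (h : y < x) : betaA α x y = 1 := by simp [betaA, h]

theorem betaA_of_gt {α x y : ℝ} (h : x < y) : betaA α x y = 0 := by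
  simp [betaA, h.not_gt, h.ne]

/-! ### The independently uniform profile as an approximate equilibrium -/

namespace Params

variable {n : ℕ} {G : Params n} {XA XB γ : ℝ} {ζA ζB : ℝ → ℝ → ℝ}

theorem isMixedStrategy_IUA (hXA : 0 < XA) (hXB : 0 < XB) (hγ : γ ∈ G.gammaSolutions XA XB) :
    IsMixedStrategy XA (G.IUA XA XB γ) := by
  have : ∀ i, IsProbabilityMeasure (G.lawA XA XB γ i) := fun i => by
    rw [lawA_eq hXA hXB hγ]
    exact isProbabilityMeasure_uniformType (atomA_nonneg hXA hγ.1 i)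
      (div_pos (lamB_pos hXA hγ.1 i) (vB_pos i)).le (cap_pos hXA hXB hγ.1 i).le (by ring)
  refine isMixedStrategy_independentRescaled hXA.le fun i => ?_
  rw [lawA_eq hXA hXB hγ]
  exact (ae_mem_Icc_uniformType (cap_pos hXA hXB hγ.1 i).le).mono fun x hx => hx.1

theorem isMixedStrategy_IUB (hXA : 0 < XA) (hXB : 0 < XB) (hγ : γ ∈ G.gammaSolutions XA XB) :
    IsMixedStrategy XB (G.IUB XA XB γ) := by
  have : ∀ i, IsProbabilityMeasure (G.lawB XA XB γ i) := fun i => by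
    rw [lawB_eq hXA hXB hγ]
    exact isProbabilityMeasure_uniformType (atomB_nonneg hXB hγ.1 i)
      (div_pos (lamA_pos hXB hγ.1 i) (vA_pos i)).le (cap_pos hXA hXB hγ.1 i).le (by ring)
  refine isMixedStrategy_independentRescaled hXB.le fun i => ?_
  rw [lawB_eq hXA hXB hγ]
  exact (ae_mem_Icc_uniformType (cap_pos hXA hXB hγ.1 i).le).mono fun x hx => hx.1

theorem payoffA_mem_Icc (hζ : IsCSF ζA ζB) {s t : Measure (Fin n → ℝ)}
    (hs : IsMixedStrategy XA s) (ht : IsMixedStrategy XB t) :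
    G.payoffA ζA s t ∈ Set.Icc 0 G.WA := by
  have := hs.1
  have := ht.1
  have b : ∀ i, ∫ x, (∫ y, ζA (max (x i) 0) (max (y i) 0) ∂t) ∂s ∈ Set.Icc (0 : ℝ) 1 := fun i => by
    have b' : ∀ x : Fin n → ℝ, ∫ y, ζA (max (x i) 0) (max (y i) 0) ∂t ∈ Set.Icc (0 : ℝ) 1 :=
      fun x => integral_mem_Icc_of_mem_unit t
        (fun y => hζ.nonneg_A _ _ (le_max_right _ _) (le_max_right _ _))
        (fun y => hζ.A_le_one (le_max_right _ _) (le_max_right _ _))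
    exact integral_mem_Icc_of_mem_unit s (fun x => (b' x).1) (fun x => (b' x).2)
  rw [payoffA_eq hζ hs ht]
  exact ⟨Finset.sum_nonneg fun i _ => mul_nonneg (G.wA_pos i).le (b i).1,
    Finset.sum_le_sum fun i _ => mul_le_of_le_one_right (G.wA_pos i).le (b i).2⟩

theorem payoffB_mem_Icc (hζ : IsCSF ζA ζB) {s t : Measure (Fin n → ℝ)}
    (hs : IsMixedStrategy XA s) (ht : IsMixedStrategy XB t) :
    G.payoffB ζB s t ∈ Set.Icc 0 G.WB := by
  have := hs.1
  have := ht.1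
  have b : ∀ i, ∫ y, (∫ x, ζB (max (x i) 0) (max (y i) 0) ∂s) ∂t ∈ Set.Icc (0 : ℝ) 1 := fun i => by
    have b' : ∀ y : Fin n → ℝ, ∫ x, ζB (max (x i) 0) (max (y i) 0) ∂s ∈ Set.Icc (0 : ℝ) 1 :=
      fun y => integral_mem_Icc_of_mem_unit s
        (fun x => hζ.nonneg_B _ _ (le_max_right _ _) (le_max_right _ _))
        (fun x => hζ.B_le_one (le_max_right _ _) (le_max_right _ _))
    exact integral_mem_Icc_of_mem_unit t (fun x => (b' x).1) (fun x => (b' x).2)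
  rw [payoffB_eq hζ hs ht]
  exact ⟨Finset.sum_nonneg fun i _ => mul_nonneg (G.wB_pos i).le (b i).1,
    Finset.sum_le_sum fun i _ => mul_le_of_le_one_right (G.wB_pos i).le (b i).2⟩

/-- Every profile is an `η`-equilibrium if `η` is at least the total value. -/
theorem isApproxEquilibrium_of_W_le (hζ : IsCSF ζA ζB) {s t : Measure (Fin n → ℝ)}
    (hs : IsMixedStrategy XA s) (ht : IsMixedStrategy XB t) {η : ℝ} (hη : G.W ≤ η) :
    G.IsApproxEquilibrium XA XB ζA ζB η s t := by
  refine ⟨hs, ht, fun s' hs' => ?_, fun t' ht' => ?_⟩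
  · have : G.WA ≤ G.W := le_max_left _ _
    linarith [(payoffA_mem_Icc (G := G) hζ hs' ht).2, (payoffA_mem_Icc (G := G) hζ hs ht).1]
  · have : G.WB ≤ G.W := le_max_right _ _
    linarith [(payoffB_mem_Icc (G := G) hζ hs ht').2, (payoffB_mem_Icc (G := G) hζ hs ht).1]

/-- The independently uniform profile is an approximate equilibrium if the sums of the independent
allocations concentrate around the budgets. -/
theorem isApproxEquilibrium_IU (i₀ : Fin n) (hζ : IsCSF ζA ζB) (hXA : 0 < XA) (hX : XA ≤ XB)
    (hγ : γ ∈ G.gammaSolutions XA XB) {δ ε t p : ℝ} (hδ : δ ∈ G.Delta XA XB ζA ζB γ ε)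
    (hcap : ∀ i, G.cap XA XB γ i ≤ 2 * XB) (ht : 0 ≤ t) (htX : 2 * t < XA)
    (hpA : (Measure.pi (G.lawA XA XB γ)).real {a | t ≤ |∑ i, a i - XA|} ≤ p)
    (hpB : (Measure.pi (G.lawB XA XB γ)).real {a | t ≤ |∑ i, a i - XB|} ≤ p)
    (hτ : 2 * t / XA + p ≤ ε) :
    G.IsApproxEquilibrium XA XB ζA ζB ((8 * δ + 13 * ε) * G.W)
      (G.IUA XA XB γ) (G.IUB XA XB γ) := by
  have hXB := hXA.trans_le hX
  have hA := lamA_pos (G := G) hXB hγ.1 i₀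
  have hB := lamB_pos (G := G) hXA hγ.1 i₀
  have eA := funext fun i => lawA_eq (G := G) hXA hXB hγ i
  have eB := funext fun i => lawB_eq (G := G) hXA hXB hγ i
  have msA := isMixedStrategy_IUA hXA hXB hγ
  have msB := isMixedStrategy_IUB hXA hXB hγ
  have := msA.1
  have := msB.1
  have hhA : ∀ i, 0 ≤ G.lamB XA γ / G.vB i := fun i => (div_pos hB (vB_pos i)).le
  have hhB : ∀ i, 0 ≤ G.lamA XB γ / G.vA i := fun i => (div_pos hA (vA_pos i)).le
  have hc : ∀ i, 0 ≤ G.cap XA XB γ i := fun i => (cap_pos hXA hXB hγ.1 i).le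
  have p0 : 0 ≤ p := measureReal_nonneg.trans hpA
  have ε0 : 0 ≤ ε := le_trans (by positivity) hτ
  have tA : ∀ f : ℝ → ℝ, (Monotone f ∨ Antitone f) → (∀ x, 0 ≤ f x) → (∀ x, f x ≤ 1) → ∀ i,
      |∫ x, f (x i) ∂G.IUA XA XB γ - ∫ x, f x ∂uniformType
        (1 - G.lamB XA γ / G.vB i * G.cap XA XB γ i) (G.lamB XA γ / G.vB i) (G.cap XA XB γ i)| ≤
      ε := by
    intro f hf f0 f1 i
    rw [IUA, eA]
    rw [eA] at hpA
    exact (abs_integral_independentRescaled_sub_le hXA ht htX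
      (fun i => atomA_nonneg hXA hγ.1 i) hhA hc (fun i => by ring) hpA hf f0 f1 i).trans hτ
  have tB : ∀ f : ℝ → ℝ, (Monotone f ∨ Antitone f) → (∀ x, 0 ≤ f x) → (∀ x, f x ≤ 1) → ∀ i,
      |∫ x, f (x i) ∂G.IUB XA XB γ - ∫ x, f x ∂uniformType
        (1 - G.lamA XB γ / G.vA i * G.cap XA XB γ i) (G.lamA XB γ / G.vA i) (G.cap XA XB γ i)| ≤
      ε := by
    intro f hf f0 f1 i
    rw [IUB, eB]
    rw [eB] at hpB
    -- Because X_A ≤ X_B, the relative error 2t / X_B is at most the one of A.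
    refine (abs_integral_independentRescaled_sub_le hXB ht (htX.trans_le hX)
      (fun i => atomB_nonneg hXB hγ.1 i) hhB hc (fun i => by ring) hpB hf f0 f1 i).trans
      (le_trans ?_ hτ)
    gcongr
  have hm0 : ∀ x : ℝ, 0 ≤ max x 0 := fun x => le_max_right _ _
  have mm : Monotone fun x : ℝ => max x 0 := fun a b hab => max_le_max_right 0 hab
  have W0 : 0 ≤ G.WA ∧ 0 ≤ G.WB := ⟨(WA_pos i₀).le, (WB_pos i₀).le⟩
  have δ0 : 0 ≤ δ := hδ.1.1
  -- With τ = ε the gain is (2δ + 5ε)V, within the claimed constants.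
  have gain : ∀ {V : ℝ}, V ≤ G.W → 0 ≤ V →
      (3 * ε + 2 * δ + 2 * ε) * V ≤ (8 * δ + 13 * ε) * G.W := fun hV V0 =>
    mul_le_mul (by linarith) hV V0 (by positivity)
  refine ⟨msA, msB, fun s' hs' => ?_, fun t' ht' => ?_⟩
  · rw [payoffA_eq hζ hs' msB, payoffA_eq hζ msA msB]
    -- The slope is w^A_i λ_A / v^A_i = W_A λ_A, the same on every battlefield.
    refine (deviation_gain_le (X := XA) (R := 2 * XB) (δ := δ) (ε := ε) (τ := ε)
      (l := G.WA * G.lamA XB γ) (ζ := fun x y => ζA (max x 0) (max y 0)) (β := betaA G.α)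
      (fun y a b hab => hζ.mono_A _ (hm0 y) (hm0 a) (hm0 b) (mm hab))
      (fun x a b hab => hζ.anti_A _ (hm0 x) (hm0 a) (hm0 b) (mm hab))
      (fun x y => hζ.nonneg_A _ _ (hm0 x) (hm0 y)) (fun x y => hζ.A_le_one (hm0 x) (hm0 y))
      (fun x y => (betaA_mem_Icc G.α_nonneg G.α_le_one x y).1)
      (fun x y => (betaA_mem_Icc G.α_nonneg G.α_le_one x y).2)
      (fun x y => betaA_of_lt) (fun x y => betaA_of_gt)
      (fun i => (G.wA_pos i).le) (fun i => atomA_nonneg hXA hγ.1 i) hhA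
      (fun i => atomB_nonneg hXB hγ.1 i) hhB hc (fun i => by ring) (fun i => by ring)
      (fun i => atomA_mul_atomB hXA hXB hγ.1 i) (fun i => ?_) (by nlinarith [W0.1])
      ?_ hcap (by linarith) ε0 (fun i x hx => ?_) hs' tA tB).trans ?_
    · have := G.wA_pos i
      have := WA_pos (G := G) i
      rw [vA]; field
    · simp_rw [← lawA_eq hXA hXB hγ]
      exact sum_integral_lawA hXA hXB hγ i₀
    · rw [← lawB_eq hXA hXB hγ]
      refine le_trans (measureReal_mono ?_ ?_) (hδ.2.2 i x hx)
      · rintro y ⟨hy, hy'⟩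
        refine ⟨hy, ?_⟩
        simp only [max_eq_left hx.1, max_eq_left hy.1] at hy'
        -- Both pairs sum to 1, so the two players' exceptional conditions coincide.
        rwa [show ζB x y - betaB G.α x y = -(ζA x y - betaA G.α x y) by
          linarith [hζ.add_eq_one x y hx.1 hy.1, betaA_add_betaB G.α x y], abs_neg]
      · rw [lawB_eq hXA hXB hγ]; exact measure_ne_top _ _
    · exact add_le_add le_rfl (gain (le_max_left _ _) W0.1)
  · rw [payoffB_eq hζ msA ht', payoffB_eq hζ msA msB]
    -- The arguments are swapped so that the deviator's allocation comes first.
    refine (deviation_gain_le (X := XB) (R := 2 * XB) (δ := δ) (ε := ε) (τ := ε)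
      (l := G.WB * G.lamB XA γ) (ζ := fun y x => ζB (max x 0) (max y 0))
      (β := fun y x => betaB G.α x y)
      (fun x a b hab => hζ.mono_B _ (hm0 x) (hm0 a) (hm0 b) (mm hab))
      (fun y a b hab => hζ.anti_B _ (hm0 y) (hm0 a) (hm0 b) (mm hab))
      (fun y x => hζ.nonneg_B _ _ (hm0 x) (hm0 y)) (fun y x => hζ.B_le_one (hm0 x) (hm0 y))
      (fun y x => ?_) (fun y x => ?_) (fun y x hxy => ?_) (fun y x hxy => ?_)
      (fun i => (G.wB_pos i).le) (fun i => atomB_nonneg hXB hγ.1 i) hhB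
      (fun i => atomA_nonneg hXA hγ.1 i) hhA hc (fun i => by ring) (fun i => by ring)
      (fun i => by rw [mul_comm]; exact atomA_mul_atomB hXA hXB hγ.1 i) (fun i => ?_)
      (by nlinarith [W0.2]) ?_ hcap (by linarith) ε0 (fun i y hy => ?_) ht' tB tA).trans ?_
    · linarith [betaA_add_betaB G.α x y, (betaA_mem_Icc G.α_nonneg G.α_le_one x y).2]
    · linarith [betaA_add_betaB G.α x y, (betaA_mem_Icc G.α_nonneg G.α_le_one x y).1]
    · linarith [betaA_add_betaB G.α x y, betaA_of_gt (α := G.α) hxy]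
    · linarith [betaA_add_betaB G.α x y, betaA_of_lt (α := G.α) hxy]
    · have := G.wB_pos i
      have := WB_pos (G := G) i
      rw [vB]; field
    · simp_rw [← lawB_eq hXA hXB hγ]
      exact sum_integral_lawB hXA hXB hγ i₀
    · rw [← lawA_eq hXA hXB hγ]
      refine le_trans (measureReal_mono ?_ ?_) (hδ.2.1 i y hy)
      · rintro x ⟨hx, hx'⟩
        refine ⟨hx, ?_⟩
        simp only [max_eq_left hx.1, max_eq_left hy.1] at hx'
        rwa [show ζA x y - betaA G.α x y = -(ζB x y - betaB G.α x y) by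
          linarith [hζ.add_eq_one x y hx.1 hy.1, betaA_add_betaB G.α x y], abs_neg]
      · rw [lawA_eq hXA hXB hγ]; exact measure_ne_top _ _
    · exact add_le_add le_rfl (gain (le_max_right _ _) W0.2)

end Params

/-! ### The error rate -/

/-- The rate `(1 + log (n + 1)) / √(n + 1)`. -/
noncomputable def rate (n : ℕ) : ℝ := (1 + Real.log (n + 1)) / √(n + 1)

theorem one_le_one_add_log (n : ℕ) : 1 ≤ 1 + Real.log ((n : ℝ) + 1) := by
  linarith [Real.log_nonneg (show (1 : ℝ) ≤ n + 1 by simp)]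

theorem rate_pos (n : ℕ) : 0 < rate n :=
  div_pos (by linarith [one_le_one_add_log n]) (by positivity)

theorem inv_le_rate (n : ℕ) : ((n : ℝ) + 1)⁻¹ ≤ rate n := by
  have h1 : (1 : ℝ) ≤ n + 1 := by simp
  calc ((n : ℝ) + 1)⁻¹ ≤ (√(n + 1))⁻¹ := by
        gcongr
        rw [Real.sqrt_le_left (by positivity)]
        nlinarith
    _ = 1 / √(n + 1) := (one_div _).symm
    _ ≤ rate n := by
        rw [rate]; gcongr; exact one_le_one_add_log n

/-- This is Hoeffding's bound for range C/n and t = 2C · `rate n`. With L = 1 + log(n + 1) the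
exponent is 8n/(n + 1) · L² ≥ L, so the exponential is at most e⁻¹/(n + 1), and 2 ≤ e absorbs the
factor 2. -/
theorem two_mul_exp_le_rate {n : ℕ} (hn : 1 ≤ n) {C : ℝ} (hC : 0 < C) :
    2 * Real.exp (-(2 * (2 * C * rate n) ^ 2 / (n * (C / n) ^ 2))) ≤ rate n := by
  refine le_trans ?_ (inv_le_rate n)
  have hn' : (1 : ℝ) ≤ n := by exact_mod_cast hn
  have hL := one_le_one_add_log n
  have e : 2 * (2 * C * rate n) ^ 2 / (n * (C / n) ^ 2) =
      8 * n / (n + 1) * (1 + Real.log (n + 1)) ^ 2 := by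
    have : √((n : ℝ) + 1) ^ 2 = n + 1 := Real.sq_sqrt (by positivity)
    rw [rate, mul_pow, div_pow, this]
    field
  have h8 : 1 ≤ 8 * (n : ℝ) / (n + 1) := by
    rw [le_div_iff₀ (by positivity)]; linarith
  have hge : 1 + Real.log ((n : ℝ) + 1) ≤ 2 * (2 * C * rate n) ^ 2 / (n * (C / n) ^ 2) := by
    rw [e]
    nlinarith
  calc 2 * Real.exp (-(2 * (2 * C * rate n) ^ 2 / (n * (C / n) ^ 2)))
      ≤ 2 * Real.exp (-(1 + Real.log (n + 1))) := by gcongr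
    _ = 2 * Real.exp (-1) * ((n : ℝ) + 1)⁻¹ := by
        rw [neg_add, Real.exp_add, Real.exp_neg (Real.log _), Real.exp_log (by positivity)]
        ring
    _ ≤ 1 * ((n : ℝ) + 1)⁻¹ := by
        gcongr
        rw [Real.exp_neg, ← div_eq_mul_inv, div_le_one (Real.exp_pos 1)]
        linarith [Real.add_one_le_exp (1 : ℝ)]
    _ = _ := one_mul _

theorem isSoftOInvSqrt_const_mul_rate (K : ℝ) : IsSoftOInvSqrt fun n => K * rate n := by
  refine ⟨1, Asymptotics.IsBigO.const_mul_left (Asymptotics.IsBigO.of_bound 3 ?_) K⟩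
  filter_upwards [eventually_ge_atTop 3] with n hn
  have hn' : (3 : ℝ) ≤ n := by exact_mod_cast hn
  have n0 : (0 : ℝ) < n := by linarith
  have hlog : 1 ≤ Real.log n := by
    rw [Real.le_log_iff_exp_le n0]
    linarith [Real.exp_one_lt_d9]
  -- This is n + 1 ≤ n²; with log n ≥ 1 it gives the constant 3.
  have hlog' : Real.log (n + 1) ≤ 2 * Real.log n := by
    rw [← Real.log_rpow n0]
    refine Real.log_le_log (by positivity) ?_
    rw [Real.rpow_two]
    nlinarith
  rw [Real.norm_of_nonneg (rate_pos n).le, Real.norm_of_nonneg (by positivity), pow_one,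
    Real.rpow_neg n0.le, ← Real.sqrt_eq_rpow, rate, div_eq_mul_inv]
  calc (1 + Real.log (n + 1)) * (√((n : ℝ) + 1))⁻¹ ≤ (3 * Real.log n) * (√(n : ℝ))⁻¹ := by
        have h : √(n : ℝ) ≤ √((n : ℝ) + 1) := Real.sqrt_le_sqrt (by linarith)
        gcongr
        linarith
    _ = _ := by ring

end LotteryBlotto

theorem mainTheorem6 (wlo whi XA XB : ℝ) (hwlo : 0 < wlo) (hw : wlo ≤ whi)
    (hXA : 0 < XA) (hX : XA ≤ XB) :
    ∃ ε : ℕ → ℝ, (∀ n, 0 < ε n) ∧ LotteryBlotto.IsSoftOInvSqrt ε ∧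
      ∀ n : ℕ, 3 ≤ n → ∀ G : LotteryBlotto.Params n, G.ValuesIn wlo whi →
        ∀ ζA ζB : ℝ → ℝ → ℝ, LotteryBlotto.IsCSF ζA ζB →
          ∀ γ ∈ G.gammaSolutions XA XB, ∀ δ ∈ G.Delta XA XB ζA ζB γ (ε n),
            G.IsApproxEquilibrium XA XB ζA ζB ((8 * δ + 13 * ε n) * G.W)
              (G.IUA XA XB γ) (G.IUB XA XB γ) := by
  open LotteryBlotto Params in
  have hXB : 0 < XB := hXA.trans_le hX
  have hwhi : 0 < whi := hwlo.trans_le hw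
  -- The constant of `card_mul_cap_le`: every cap is at most C/n.
  set C : ℝ := whi / wlo * (4 * XB) with hC
  have C0 : 0 < C := by positivity
  have K0 : 0 < 4 * C / XA + 1 := by positivity
  -- This is 2t / X_A + p for t = 2C · `rate n` and p = `rate n`.
  refine ⟨fun n => (4 * C / XA + 1) * rate n, fun n => mul_pos K0 (rate_pos n),
    isSoftOInvSqrt_const_mul_rate _, ?_⟩
  intro n hn G hG ζA ζB hζ γ hγ δ hδ
  beta_reduce at hδ ⊢
  have i₀ : Fin n := ⟨0, by omega⟩
  have hr := rate_pos n
  -- If ε(n) ≥ 1, the allowed error exceeds every payoff. Otherwise ε(n) < 1 yields 2t < X_A, as the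
  -- rescaling estimate requires.
  rcases le_or_gt 1 ((4 * C / XA + 1) * rate n) with h1 | h1
  · refine isApproxEquilibrium_of_W_le hζ (isMixedStrategy_IUA hXA hXB hγ)
      (isMixedStrategy_IUB hXA hXB hγ) ?_
    have W0 : 0 ≤ G.W := (WA_pos (G := G) i₀).le.trans (le_max_left _ _)
    exact le_mul_of_one_le_left W0 (by linarith [hδ.1.1])
  have n1 : (3 : ℝ) ≤ n := by exact_mod_cast hn
  have n0 : (0 : ℝ) < n := by linarith
  have hcapC : ∀ i, G.cap XA XB γ i ≤ C / n := fun i => by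
    rw [le_div_iff₀ n0, mul_comm]
    exact card_mul_cap_le hwlo hG hXA hX hγ i
  have htX : 2 * (2 * C * rate n) < XA := by
    have : 4 * C / XA * rate n < 1 := by linarith
    rw [div_mul_eq_mul_div, div_lt_one hXA] at this
    linarith
  -- With `htX` this keeps the supports inside [0, 2 X_B], the window in which δ controls the CSF.
  have hCn : C / n ≤ 2 * C * rate n := by
    have := mul_le_mul_of_nonneg_left (inv_le_rate n) (by positivity : (0 : ℝ) ≤ 2 * C)
    refine le_trans ?_ this
    rw [← div_eq_mul_inv, div_le_div_iff₀ n0 (by positivity)]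
    nlinarith
  have conc : ∀ F : Fin n → Measure ℝ, (∀ i, ∃ m h, 0 ≤ m ∧ 0 ≤ h ∧
      m + h * G.cap XA XB γ i = 1 ∧ F i = uniformType m h (G.cap XA XB γ i)) → ∀ X,
      ∑ i, ∫ x, x ∂F i = X →
      (Measure.pi F).real {a | 2 * C * rate n ≤ |∑ i, a i - X|} ≤ rate n := by
    rintro F hF X rfl
    have hc : ∀ i, 0 ≤ G.cap XA XB γ i := fun i => (cap_pos hXA hXB hγ.1 i).le
    have : ∀ i, IsProbabilityMeasure (F i) := fun i => by
      obtain ⟨m, h, m0, h0, e1, e2⟩ := hF i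
      rw [e2]
      exact isProbabilityMeasure_uniformType m0 h0 (hc i) e1
    refine (pi_real_le_abs_sum_sub (D := C / n) (fun i => ?_) (by positivity)).trans
      (two_mul_exp_le_rate (by omega) C0)
    obtain ⟨m, h, -, -, -, e2⟩ := hF i
    rw [e2]
    exact (ae_mem_Icc_uniformType (hc i)).mono fun x hx => ⟨hx.1, hx.2.trans (hcapC i)⟩
  refine isApproxEquilibrium_IU i₀ hζ hXA hX hγ (t := 2 * C * rate n) (p := rate n) hδ
    (fun i => ?_) (by positivity) htX (conc _ (fun i => ?_) _ (sum_integral_lawA hXA hXB hγ i₀))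
    (conc _ (fun i => ?_) _ (sum_integral_lawB hXA hXB hγ i₀)) (le_of_eq (by ring))
  · linarith [hcapC i]
  · exact ⟨_, _, atomA_nonneg hXA hγ.1 i, (div_pos (lamB_pos hXA hγ.1 i) (vB_pos i)).le,
      by ring, lawA_eq hXA hXB hγ i⟩
  · exact ⟨_, _, atomB_nonneg hXB hγ.1 i, (div_pos (lamA_pos hXB hγ.1 i) (vA_pos i)).le,
      by ring, lawB_eq hXA hXB hγ i⟩
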